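/- Let $\mathbb H$ be the space of quaternions with its Euclidean metric $g_V$, regarded as a complex vector space through right multiplication ($\lambda\cdot q=q\lambda$ for $\lambda\in\mathbb C\subset\mathbb H$), and let $\omega_V(u,v)=g_V(ui,v)$. Let $\Gamma\subset\mathbb H$ be a lattice, let $M=\mathbb H/\Gamma$ be the quotient $4$-torus, with the induced flat metric $g_M$ and symplectic form $\omega_M$, oriented by $\omega_M^2$, and let $\rho:TM\to\mathbb H$ be the canonical trivialization. For a smooth map $f:M\to M$ let $\mathscr Df=\rho\circ f_*\in\Omega^1(M,\mathbb H)$. Left multiplications by $i,j,k$ on $\mathbb H$ induce almost complex structures $I,J,K$ on $M$, and the hyperKähler moment map $\boldsymbol\mu=(\mu_I,\mu_J,\mu_K)$ on $\Omega^1(M,\mathbb H)$ is given, for $\bullet=I,J,K$, by $\mu_\bullet(F)=-\tfrac12\, g(\mathscr R_\bullet F,F)$, where $\mathscr R_\bullet F=-(F\circ\bullet)\,i$ and $g$ is the pointwise inner product on $T^*M\otimes\mathbb H$ induced by $g_M$ and $g_V$. (1) A smooth map $f:M\to M$ is homotopic to a symplectic diffeomorphism of $(M,\omega_M)$ if and only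 if $f^*[\omega_M]=[\omega_M]$ in de Rham cohomology. (2) Let $f:M\to M$ be a smooth map that is homotopic to a symplectic diffeomorphism of $(M,\omega_M)$, or equivalently such that $f^*[\omega_M]=[\omega_M]$. Then $f$ is a symplectic diffeomorphism of $(M,\omega_M)$ if and only if $\boldsymbol\mu(\mathscr Df)=0$. (3) For every smooth map $f:M\to M$, the condition $\boldsymbol\mu(\mathscr Df)=0$ holds if and only if $f^*\omega_M$ is self-dual, and if and only if $f^*\omega_M$ is a self-dual harmonic form. (4) Every exact self-dual $2$-form on $M$ vanishes. -/

import Mathlib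

open scoped Manifold ContDiff Topology Quaternion

namespace HyperKahlerTorus

noncomputable section

/-! ### The quaternionic vector space and its linear structures -/

/-- The quaternion `i`. -/
def qi : ℍ[ℝ] := ⟨0, 1, 0, 0⟩

/-- The quaternion `j`. -/
def qj : ℍ[ℝ] := ⟨0, 0, 1, 0⟩

/-- The quaternion `k`. -/
def qk : ℍ[ℝ] := ⟨0, 0, 0, 1⟩

/-- The complex structure `v ↦ i · v := v i` of the complex vector space `ℍ`:
complex scalars act by quaternionic multiplication on the right. -/
def rightI : ℍ[ℝ] →L[ℝ] ℍ[ℝ] := (ContinuousLinearMap.mul ℝ ℍ[ℝ]).flip qi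

/-- The endomorphism `v ↦ q v`, quaternionic multiplication by `q` on the left. The almost complex
structures `I`, `J`, `K` are `leftMul qi`, `leftMul qj`, `leftMul qk`. -/
def leftMul (q : ℍ[ℝ]) : ℍ[ℝ] →L[ℝ] ℍ[ℝ] := ContinuousLinearMap.mul ℝ ℍ[ℝ] q

/-- The standard frame `1, i, j, k` of `ℍ`, orthonormal for the Euclidean metric
`g_V = inner ℝ`. -/
def frame : Fin 4 → ℍ[ℝ] := ![1, qi, qj, qk]

theorem inner_rightI_self (v : ℍ[ℝ]) : inner ℝ (rightI v) v = 0 := by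
  change inner ℝ (v * qi) v = 0
  have h0 : qi.re = 0 := rfl
  have h1 : qi.imI = 1 := rfl
  have h2 : qi.imJ = 0 := rfl
  have h3 : qi.imK = 0 := rfl
  simp only [Quaternion.inner_def, Quaternion.re_mul, Quaternion.imI_mul, Quaternion.imJ_mul,
    Quaternion.imK_mul, Quaternion.re_star, Quaternion.imI_star, Quaternion.imJ_star,
    Quaternion.imK_star, h0, h1, h2, h3]
  ring

/-- The symplectic form `ω_V(u, v) = g_V(u i, v)` of `ℍ`, the imaginary part of the Hermitian
metric `h_V = g_V + i ω_V` (which is antilinear in the first variable). -/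
def omegaV : ℍ[ℝ] [⋀^Fin 2]→L[ℝ] ℝ where
  toFun v := inner ℝ (rightI (v 0)) (v 1)
  map_update_add' m i x y := by
    fin_cases i <;> simp [Function.update, inner_add_left, inner_add_right]
  map_update_smul' m i c x := by
    fin_cases i <;> simp [Function.update, inner_smul_left, inner_smul_right]
  cont := by fun_prop
  map_eq_zero_of_eq' v i j h hij := by
    fin_cases i <;> fin_cases j <;> simp at h hij ⊢
    · rw [h]; exact inner_rightI_self _
    · rw [h]; exact inner_rightI_self _

/-- The wedge product `α ∧ β` of two alternating `2`-forms on `ℍ`, evaluated on four vectors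
(sum over the `(2,2)`-shuffles). -/
def wedge (α β : ℍ[ℝ] [⋀^Fin 2]→L[ℝ] ℝ) (u : Fin 4 → ℍ[ℝ]) : ℝ :=
  α ![u 0, u 1] * β ![u 2, u 3] - α ![u 0, u 2] * β ![u 1, u 3] + α ![u 0, u 3] * β ![u 1, u 2]
    + α ![u 1, u 2] * β ![u 0, u 3] - α ![u 1, u 3] * β ![u 0, u 2] + α ![u 2, u 3] * β ![u 0, u 1]

/-- The volume form `σ_V = ω_V ∧ ω_V / 2`, evaluated on four vectors. -/
def volV (u : Fin 4 → ℍ[ℝ]) : ℝ := wedge omegaV omegaV u / 2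

/-- The inner product of `Λ² ℍ*` induced by `g_V`:
`g(α, β) = ∑_{a < b} α(e_a, e_b) β(e_a, e_b)` for the orthonormal frame `e`. -/
def innerTwo (α β : ℍ[ℝ] [⋀^Fin 2]→L[ℝ] ℝ) : ℝ :=
  ∑ a : Fin 4, ∑ b ∈ Finset.Ioi a, α ![frame a, frame b] * β ![frame a, frame b]

/-- `α' = * α` for the Hodge operator `*` of `Λ² ℍ*` given by the metric `g_V` and the orientation
of `ω_V`, that is `β ∧ * α = g(β, α) σ_V` for every `β`. This determines `α'` uniquely. -/
def IsHodgeStar (α α' : ℍ[ℝ] [⋀^Fin 2]→L[ℝ] ℝ) : Prop :=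
  ∀ (β : ℍ[ℝ] [⋀^Fin 2]→L[ℝ] ℝ) (u : Fin 4 → ℍ[ℝ]), wedge β α' u = innerTwo β α * volV u

/-! ### The torus `M = ℍ / Γ` as a smooth manifold -/

section Torus

variable (Γ : Submodule ℤ ℍ[ℝ])

/-- The torus `M = V / Γ`, with the quotient topology. -/
abbrev Torus : Type := ℍ[ℝ] ⧸ Γ.toAddSubgroup

/-- The covering projection `p : V → M`. -/
def proj (z : ℍ[ℝ]) : Torus Γ := QuotientAddGroup.mk z

theorem proj_surjective : Function.Surjective (proj Γ) := QuotientAddGroup.mk_surjective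

theorem proj_eq_iff {y z : ℍ[ℝ]} : proj Γ y = proj Γ z ↔ z - y ∈ Γ := by
  unfold proj
  rw [QuotientAddGroup.eq, neg_add_eq_sub]
  rfl

variable [DiscreteTopology Γ]

theorem isLocalHomeomorph_proj : IsLocalHomeomorph (proj Γ) :=
  (AddSubgroup.isAddQuotientCoveringMap_of_comm Γ.toAddSubgroup
    (by constructor; exact inferInstanceAs (DiscreteTopology Γ))).isCoveringMap.isLocalHomeomorph

/-- The smooth structure of `M`: the charts are the local inverses of the covering projection. -/
instance : ChartedSpace ℍ[ℝ] (Torus Γ) :=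
  (isLocalHomeomorph_proj Γ).chartedSpace (proj_surjective Γ)

variable {Γ}

theorem proj_chart {e : OpenPartialHomeomorph (Torus Γ) ℍ[ℝ]} (he : e ∈ atlas ℍ[ℝ] (Torus Γ)) :
    (e.symm : ℍ[ℝ] → Torus Γ) = proj Γ := by
  obtain ⟨q, rfl⟩ := he
  ext z
  simp only [OpenPartialHomeomorph.trans_symm_eq_symm_trans_symm, OpenPartialHomeomorph.coe_trans,
    IsLocalHomeomorph.localInverseAt_symm, chartAt_self_eq, OpenPartialHomeomorph.refl_symm,
    OpenPartialHomeomorph.refl_apply, Function.comp_apply, id_eq]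

/-- A chart composed with the covering projection is locally a translation. -/
theorem chart_proj {e : OpenPartialHomeomorph (Torus Γ) ℍ[ℝ]} (he : e ∈ atlas ℍ[ℝ] (Torus Γ))
    {z : ℍ[ℝ]} (hz : proj Γ z ∈ e.source) :
    ∃ c : ℍ[ℝ], (fun y => e (proj Γ y)) =ᶠ[𝓝 z] fun y => y + c := by
  have hcont : ContinuousAt (fun y => e (proj Γ y) - y) z :=
    ((e.continuousAt hz).comp (isLocalHomeomorph_proj Γ).continuous.continuousAt).sub
      continuousAt_id
  have hmem : ∀ y, proj Γ y ∈ e.source → e (proj Γ y) - y ∈ Γ := by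
    intro y hy
    rw [← proj_eq_iff, ← proj_chart he, e.left_inv (by rw [proj_chart he]; exact hy)]
  obtain ⟨U, hU, hU0⟩ : ∃ U ∈ 𝓝 (e (proj Γ z) - z), U ∩ (Γ : Set ℍ[ℝ]) = {e (proj Γ z) - z} := by
    have : IsDiscrete (Γ : Set ℍ[ℝ]) := ⟨inferInstanceAs (DiscreteTopology Γ)⟩
    exact nhds_inter_eq_singleton_of_mem_discrete this (hmem z hz)
  refine ⟨e (proj Γ z) - z, ?_⟩
  have h1 : ∀ᶠ y in 𝓝 z, proj Γ y ∈ e.source :=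
    (isLocalHomeomorph_proj Γ).continuous.continuousAt (e.open_source.mem_nhds hz)
  filter_upwards [hcont hU, h1] with y hy hy'
  have : e (proj Γ y) - y ∈ U ∩ (Γ : Set ℍ[ℝ]) := ⟨hy, hmem y hy'⟩
  rw [hU0, Set.mem_singleton_iff] at this
  rw [← this]
  abel

instance : IsManifold 𝓘(ℝ, ℍ[ℝ]) ∞ (Torus Γ) := by
  apply isManifold_of_contDiffOn
  intro e e' he he' z hz
  simp only [modelWithCornersSelf_coe, modelWithCornersSelf_coe_symm, Set.preimage_id,
    Set.range_id, Set.inter_univ, OpenPartialHomeomorph.trans_source, Set.mem_inter_iff,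
    Set.mem_preimage, proj_chart he] at hz
  obtain ⟨c, hc⟩ := chart_proj he' hz.2
  apply ContDiffAt.contDiffWithinAt
  have : (fun y : ℍ[ℝ] => y + c) =ᶠ[𝓝 z] (𝓘(ℝ, ℍ[ℝ]) ∘ e.symm ≫ₕ e' ∘ 𝓘(ℝ, ℍ[ℝ]).symm) := by
    filter_upwards [hc] with y hy
    simp [proj_chart he, hy]
  exact (contDiffAt_id.add contDiffAt_const).congr_of_eventuallyEq this.symm

theorem contMDiff_proj : ContMDiff 𝓘(ℝ, ℍ[ℝ]) 𝓘(ℝ, ℍ[ℝ]) ∞ (proj Γ) := by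
  intro z
  rw [contMDiffAt_iff_target]
  refine ⟨(isLocalHomeomorph_proj Γ).continuous.continuousAt, ?_⟩
  obtain ⟨c, hc⟩ := chart_proj (chart_mem_atlas ℍ[ℝ] (proj Γ z)) (mem_chart_source ℍ[ℝ] (proj Γ z))
  have : (fun y : ℍ[ℝ] => y + c) =ᶠ[𝓝 z] (extChartAt 𝓘(ℝ, ℍ[ℝ]) (proj Γ z) ∘ proj Γ) := by
    filter_upwards [hc] with y hy
    simp [hy]
  exact (contDiffAt_id.add contDiffAt_const).contMDiffAt.congr_of_eventuallyEq this.symm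

/-- The canonical trivialization `ρ : TM → V` of the tangent bundle. The tangent space at `x` is
expressed in a chart, and the charts are local inverses of the projection `p`, so `ρ` is the
identity in charts; `rho_mfderiv_proj` says that `ρ ∘ p_*` is the identity of `V`, which
characterizes `ρ`. -/
def rho (x : Torus Γ) : TangentSpace 𝓘(ℝ, ℍ[ℝ]) x ≃L[ℝ] ℍ[ℝ] :=
  ContinuousLinearEquiv.refl ℝ ℍ[ℝ]

theorem rho_mfderiv_proj (z v : ℍ[ℝ]) :
    rho (proj Γ z) (mfderiv 𝓘(ℝ, ℍ[ℝ]) 𝓘(ℝ, ℍ[ℝ]) (proj Γ) z v) = v := by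
  obtain ⟨c, hc⟩ := chart_proj (chart_mem_atlas ℍ[ℝ] (proj Γ z)) (mem_chart_source ℍ[ℝ] (proj Γ z))
  have hd : MDifferentiableAt 𝓘(ℝ, ℍ[ℝ]) 𝓘(ℝ, ℍ[ℝ]) (proj Γ) z :=
    (contMDiff_proj z).mdifferentiableAt (by simp)
  have : mfderiv 𝓘(ℝ, ℍ[ℝ]) 𝓘(ℝ, ℍ[ℝ]) (proj Γ) z = ContinuousLinearMap.id ℝ ℍ[ℝ] := by
    have h : writtenInExtChartAt 𝓘(ℝ, ℍ[ℝ]) 𝓘(ℝ, ℍ[ℝ]) z (proj Γ) =ᶠ[𝓝 z] fun y => y + c := by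
      filter_upwards [hc] with y hy
      exact hy
    have h' : HasFDerivAt (fun y : ℍ[ℝ] => y + c) (ContinuousLinearMap.id ℝ ℍ[ℝ]) z :=
      (hasFDerivAt_id z).add_const c
    exact HasMFDerivAt.mfderiv
      ⟨hd.continuousAt, (h'.congr_of_eventuallyEq h).hasFDerivWithinAt⟩
  rw [this]
  rfl

end Torus

/-! ### Differential forms on the torus -/

section Forms

variable (Γ : Submodule ℤ ℍ[ℝ]) [DiscreteTopology Γ]

/-- The space `𝓜` of smooth maps `f : M → M`. -/
abbrev SmoothMap : Type := C^∞⟮𝓘(ℝ, ℍ[ℝ]), Torus Γ; 𝓘(ℝ, ℍ[ℝ]), Torus Γ⟯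

/-- Real-valued `k`-forms on `M` (not necessarily continuous): an alternating form on each tangent
space. -/
abbrev Form (k : ℕ) : Type := ∀ x : Torus Γ, TangentSpace 𝓘(ℝ, ℍ[ℝ]) x [⋀^Fin k]→L[ℝ] ℝ

/-- `V`-valued `1`-forms on `M`. -/
abbrev VForm : Type := ∀ x : Torus Γ, TangentSpace 𝓘(ℝ, ℍ[ℝ]) x →L[ℝ] ℍ[ℝ]

variable {Γ}

/-- The pullback `p^* α` of a form by the covering projection `p : V → M`, a form on `V`. -/
def Form.lift {k : ℕ} (α : Form Γ k) : ℍ[ℝ] → ℍ[ℝ] [⋀^Fin k]→L[ℝ] ℝ := fun z =>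
  (α (proj Γ z)).compContinuousLinearMap (mfderiv 𝓘(ℝ, ℍ[ℝ]) 𝓘(ℝ, ℍ[ℝ]) (proj Γ) z)

/-- A form on `M` is smooth: its pullback by the surjective local diffeomorphism `p` is smooth. -/
def Form.IsSmooth {k : ℕ} (α : Form Γ k) : Prop := ContDiff ℝ ∞ α.lift

/-- `β = d α` on `M`. Since `p` is a surjective local diffeomorphism, this is equivalent to
`p^* β = d (p^* α)` on `V`. -/
def Form.IsExtDeriv {k : ℕ} (α : Form Γ k) (β : Form Γ (k + 1)) : Prop :=
  β.lift = extDeriv α.lift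

/-- `β` is exact: it is `d η` for a smooth form `η` on `M`. -/
def Form.IsExact {k : ℕ} (β : Form Γ (k + 1)) : Prop :=
  ∃ η : Form Γ k, η.IsSmooth ∧ η.IsExtDeriv β

/-- The pullback `f^* α` of a form by a map `f : M → M`. -/
def Form.pullback {k : ℕ} (f : Torus Γ → Torus Γ) (α : Form Γ k) : Form Γ k := fun x =>
  (α (f x)).compContinuousLinearMap (mfderiv 𝓘(ℝ, ℍ[ℝ]) 𝓘(ℝ, ℍ[ℝ]) f x)

/-- A `2`-form on `M` is self-dual, `* α = α`, for the metric `g_M = ρ^* g_V` and the orientation of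
`ω_M`: at each point it is the pullback by `ρ` of a form on `V` which is its own Hodge dual. -/
def Form.IsSelfDual (α : Form Γ 2) : Prop :=
  ∀ x, IsHodgeStar ((α x).compContinuousLinearMap (rho x).symm)
    ((α x).compContinuousLinearMap (rho x).symm)

/-- The codifferential `δ η = - ∑_a ι_{e_a} ∇_{e_a} η` of a form on the Euclidean space `V`. -/
def codiff {k : ℕ} (η : ℍ[ℝ] → ℍ[ℝ] [⋀^Fin (k + 1)]→L[ℝ] ℝ) (z : ℍ[ℝ]) :
    ℍ[ℝ] [⋀^Fin k]→L[ℝ] ℝ :=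
  -∑ a : Fin 4, (fderiv ℝ η z (frame a)).curryLeft (frame a)

/-- A smooth form on `M` (of positive degree) is harmonic: `(d δ + δ d) α = 0`. The Hodge Laplacian
of the flat metric `g_M` is computed on `V`, since `p` is a surjective local isometry. -/
def Form.IsHarmonic {k : ℕ} (α : Form Γ (k + 1)) : Prop :=
  α.IsSmooth ∧ ∀ z, extDeriv (codiff α.lift) z + codiff (extDeriv α.lift) z = 0

variable (Γ) in
/-- The Kähler form `ω_M = ρ^* ω_V`. -/
def omegaM : Form Γ 2 := fun x => omegaV.compContinuousLinearMap (rho x : _ →L[ℝ] ℍ[ℝ])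

/-! ### Symplectic diffeomorphisms and the moment map -/

/-- `f` is a symplectic diffeomorphism of `(M, ω_M)`. -/
def IsSymplecticDiffeo (f : SmoothMap Γ) : Prop :=
  (∃ Φ : Diffeomorph 𝓘(ℝ, ℍ[ℝ]) 𝓘(ℝ, ℍ[ℝ]) (Torus Γ) (Torus Γ) ∞, ∀ x, Φ x = f x) ∧
    (omegaM Γ).pullback f = omegaM Γ

/-- `f` is homotopic to a symplectic diffeomorphism of `(M, ω_M)`. -/
def IsHomotopicToSymplectic (f : SmoothMap Γ) : Prop :=
  ∃ g : SmoothMap Γ, IsSymplecticDiffeo g ∧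
    ContinuousMap.Homotopic (⟨f, f.contMDiff.continuous⟩ : C(Torus Γ, Torus Γ))
      ⟨g, g.contMDiff.continuous⟩

/-- `f^* [ω_M] = [ω_M]` in de Rham cohomology. -/
def PreservesClass (f : SmoothMap Γ) : Prop :=
  Form.IsExact (k := 1) ((omegaM Γ).pullback f - omegaM Γ)

/-- The differential `𝒟 f = ρ ∘ f_*` of a map `f : M → M`, a `V`-valued `1`-form on `M`. -/
def differential (f : Torus Γ → Torus Γ) : VForm Γ := fun x =>
  (rho (f x) : _ →L[ℝ] ℍ[ℝ]).comp (mfderiv 𝓘(ℝ, ℍ[ℝ]) 𝓘(ℝ, ℍ[ℝ]) f x)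

/-- The inner product of `T*_x M ⊗ V` induced by `g_M` and `g_V`. -/
def innerOne (x : Torus Γ) (F G : TangentSpace 𝓘(ℝ, ℍ[ℝ]) x →L[ℝ] ℍ[ℝ]) : ℝ :=
  ∑ a : Fin 4, inner ℝ (F ((rho x).symm (frame a))) (G ((rho x).symm (frame a)))

/-- The almost complex structure `F ↦ - F ∘ A_M` on `V`-valued `1`-forms induced by an almost complex
structure `A` of `V`, where `A_M` is the endomorphism of `TM` deduced from `A` through `ρ`. -/
def formStructure (A : ℍ[ℝ] →L[ℝ] ℍ[ℝ]) (F : VForm Γ) : VForm Γ := fun x =>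
  -(F x).comp (((rho x).symm : ℍ[ℝ] →L[ℝ] _).comp (A.comp (rho x : _ →L[ℝ] ℍ[ℝ])))

/-- The involution `ℛ F = i (A · F)`, where `i` multiplies the values. -/
def involution (A : ℍ[ℝ] →L[ℝ] ℍ[ℝ]) (F : VForm Γ) : VForm Γ := fun x =>
  rightI.comp (formStructure A F x)

/-- The moment map `μ(F) = - g(ℛ F, F) / 2` of the action of `C^∞(M, S¹)` on `V`-valued `1`-forms,
for the Kähler structure induced by the almost complex structure `A`. -/
def momentMap (A : ℍ[ℝ] →L[ℝ] ℍ[ℝ]) (F : VForm Γ) : Torus Γ → ℝ := fun x =>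
  -(1 / 2) * innerOne x (involution A F x) (F x)

/-- The hyperKähler moment map `𝛍 = (μ_I, μ_J, μ_K)`. -/
def hyperMomentMap (F : VForm Γ) : Fin 3 → Torus Γ → ℝ :=
  ![momentMap (leftMul qi) F, momentMap (leftMul qj) F, momentMap (leftMul qk) F]

end Forms

end

end HyperKahlerTorus

open HyperKahlerTorus

/-!
The components of `μ(𝒟 f)` are, up to a factor, the inner products of `f^* ω_M` with `g_M(I ·, ·)`,
`g_M(J ·, ·)` and `g_M(K ·, ·)`. These span the anti-self-dual forms at each point, so that the
moment map vanishes exactly when `f^* ω_M` is self-dual. A closed self-dual form is coclosed, and an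
exact one, `dη`, then satisfies `∫ |dη|² = 0` by Stokes' theorem.

A map `f` of the torus has a lift `F` to `ℍ` with `F (z + w) = F z + A w` for `w ∈ Γ`, where `A` is
linear. The form `f^* ω_M - A^* ω_V` is exact and a constant exact form vanishes, hence `f`
preserves the class of `ω_M` if and only if `A` is symplectic. In that case `A` restricts to an
automorphism of `Γ` and induces a symplectic diffeomorphism of `M`, to which `f` is homotopic
because `F - A` is periodic. If moreover `f^* ω_M` is self-dual, then the exact self-dual form
`f^* ω_M - ω_M` is zero, and `F` is a local diffeomorphism at bounded distance from `A`, thus a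
diffeomorphism by Hadamard's theorem.
-/

namespace HyperKahlerTorus

/-! ### Periodic functions over a lattice -/

section Periodic

open MeasureTheory
open scoped Pointwise

variable {E F : Type*} [NormedAddCommGroup E] [NormedAddCommGroup F]

section Derivative

variable [NormedSpace ℝ E]

theorem periodic_fderiv [NormedSpace ℝ F] {f : E → F} {w : E} (hf : Function.Periodic f w) :
    Function.Periodic (fderiv ℝ f) w := fun z => by
  rw [← fderiv_comp_add_right, funext hf]

theorem periodic_fderiv_apply [NormedSpace ℝ F] {f : E → F} {w : E} (hf : Function.Periodic f w)
    (v : E) : Function.Periodic (fun z => fderiv ℝ f z v) w := fun z =>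
  DFunLike.congr_fun (periodic_fderiv hf z) v

theorem periodic_extDeriv [NormedSpace ℝ F] {k : ℕ} {η : E → E [⋀^Fin k]→L[ℝ] F} {w : E}
    (hη : Function.Periodic η w) : Function.Periodic (extDeriv η) w := fun z =>
  congrArg ContinuousAlternatingMap.alternatizeUncurryFin (periodic_fderiv hη z)

theorem exists_norm_le_of_periodic [FiniteDimensional ℝ E] (L : Submodule ℤ E)
    [DiscreteTopology L] [IsZLattice ℝ L] {f : E → F} (hf : Continuous f)
    (hper : ∀ w ∈ L, Function.Periodic f w) : ∃ C, ∀ z, ‖f z‖ ≤ C := by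
  obtain ⟨C, hC⟩ := (IsZLattice.isCompact_range_of_periodic L f hf
    fun z w hw => hper w hw z).isBounded.exists_norm_le
  exact ⟨C, fun z => hC _ ⟨z, rfl⟩⟩

end Derivative

section ExteriorDerivative

variable [NormedSpace ℝ E] [NormedSpace ℝ F] {k : ℕ} {η : E → E [⋀^Fin k]→L[ℝ] F}

theorem contDiff_form_apply {n : ℕ∞ω} (hη : ContDiff ℝ n η) (v : Fin k → E) :
    ContDiff ℝ n fun z => η z v :=
  (ContinuousAlternatingMap.apply ℝ E F v).contDiff.comp hη

theorem contDiff_extDeriv {m n : ℕ∞ω} (hη : ContDiff ℝ n η) (hmn : m + 1 ≤ n) :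
    ContDiff ℝ m (extDeriv η) := by
  have h : extDeriv η = ContinuousAlternatingMap.alternatizeUncurryFinCLM ℝ E F ∘ fderiv ℝ η := rfl
  rw [h]
  exact (ContinuousLinearMap.contDiff _).comp (hη.fderiv_right hmn)

theorem extDeriv_const (κ : E [⋀^Fin k]→L[ℝ] F) : extDeriv (fun _ : E => κ) = 0 := by
  funext z
  rw [extDeriv, fderiv_fun_const]
  exact map_zero (ContinuousAlternatingMap.alternatizeUncurryFinCLM ℝ E F)

theorem extDeriv_sub {θ : E → E [⋀^Fin k]→L[ℝ] F} {z : E} (hη : DifferentiableAt ℝ η z)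
    (hθ : DifferentiableAt ℝ θ z) : extDeriv (η - θ) z = extDeriv η z - extDeriv θ z := by
  rw [extDeriv, fderiv_sub hη hθ]
  exact map_sub (ContinuousAlternatingMap.alternatizeUncurryFinCLM ℝ E F) _ _

end ExteriorDerivative

section Invariance

variable [MeasurableSpace E] [BorelSpace E] (μ : Measure E) [μ.IsAddLeftInvariant]

theorem vaddInvariantMeasure_submodule (L : Submodule ℤ E) : VAddInvariantMeasure L E μ :=
  ⟨fun c s _ => measure_preimage_add μ (c : E) s⟩

variable {μ} {L : Submodule ℤ E} [Countable L] {D : Set E} (hD : IsAddFundamentalDomain L D μ)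
include hD

theorem setIntegral_comp_add_right_of_periodic [NormedSpace ℝ F] {f : E → F}
    (hf : ∀ w ∈ L, Function.Periodic f w) (v : E) :
    ∫ z in D, f (z + v) ∂μ = ∫ z in D, f z ∂μ := by
  have := vaddInvariantMeasure_submodule μ L
  have hpre : (fun z => z + v) ⁻¹' (v +ᵥ D) = D := by
    ext z
    rw [Set.mem_preimage, Set.mem_vadd_set_iff_neg_vadd_mem, vadd_eq_add, neg_add_cancel_comm_assoc]
  calc ∫ z in D, f (z + v) ∂μ = ∫ z in v +ᵥ D, f z ∂μ := by
        rw [← (measurePreserving_add_right μ v).setIntegral_preimage_emb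
          (measurableEmbedding_addRight v) f, hpre]
    _ = ∫ z in D, f z ∂μ := (hD.vadd_of_comm v).setIntegral_eq hD fun w z => by
        rw [Submodule.vadd_def, vadd_eq_add, add_comm, hf w w.2 z]

theorem eq_zero_of_periodic_of_setIntegral_eq_zero [μ.IsOpenPosMeasure] {f : E → ℝ}
    (hf : Continuous f) (hper : ∀ w ∈ L, Function.Periodic f w) (hint : IntegrableOn f D μ)
    (hnonneg : 0 ≤ f) (hzero : ∫ z in D, f z ∂μ = 0) : f = 0 := by
  have := vaddInvariantMeasure_submodule μ L
  have hnull : μ ({z | f z ≠ 0} ∩ D) = 0 := by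
    rw [← Measure.restrict_apply (isOpen_ne_fun hf continuous_const).measurableSet]
    exact (integral_eq_zero_iff_of_nonneg hnonneg hint).1 hzero
  have hinv : ∀ w : L, w +ᵥ {z | f z ≠ 0} = {z | f z ≠ 0} := fun w => by
    ext z
    rw [Set.mem_vadd_set_iff_neg_vadd_mem, Submodule.vadd_def, vadd_eq_add, add_comm,
      Set.mem_ofPred_eq, hper _ (-w).2 z, Set.mem_ofPred_eq]
  exact (hf.ae_eq_iff_eq μ continuous_zero).1 (hD.measure_zero_of_invariant _ hinv hnull)

end Invariance

section Lattice

variable [NormedSpace ℝ E] [FiniteDimensional ℝ E] [MeasurableSpace E]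
  [BorelSpace E] {μ : Measure E} {L : Submodule ℤ E} [DiscreteTopology L] [IsZLattice ℝ L]
  {D : Set E}

variable (μ L) in
theorem exists_isAddFundamentalDomain_measure_ne_top [μ.IsAddHaarMeasure] :
    ∃ D, IsAddFundamentalDomain L D μ ∧ μ D ≠ ⊤ := by
  have := ZLattice.module_free ℝ L
  exact ⟨_, ZLattice.isAddFundamentalDomain (Module.Free.chooseBasis ℤ L) μ,
    (ZSpan.fundamentalDomain_isBounded _).measure_lt_top.ne⟩

theorem integrableOn_of_periodic (hD : μ D ≠ ⊤) {f : E → F} (hf : Continuous f)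
    (hper : ∀ w ∈ L, Function.Periodic f w) : IntegrableOn f D μ := by
  obtain ⟨C, hC⟩ := exists_norm_le_of_periodic L hf hper
  exact Measure.integrableOn_of_bounded hD hf.aestronglyMeasurable (.of_forall hC)

variable [NormedSpace ℝ F]

theorem hasDerivAt_setIntegral_comp_add_smul (hD : μ D ≠ ⊤) {f : E → F} (hf : ContDiff ℝ 1 f)
    (hper : ∀ w ∈ L, Function.Periodic f w) (v : E) :
    HasDerivAt (fun t : ℝ => ∫ z in D, f (z + t • v) ∂μ) (∫ z in D, fderiv ℝ f z v ∂μ) 0 := by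
  have hcont' : Continuous fun z => fderiv ℝ f z v :=
    (hf.continuous_fderiv one_ne_zero).clm_apply continuous_const
  obtain ⟨C, hC⟩ := exists_norm_le_of_periodic L hcont' fun w hw =>
    periodic_fderiv_apply (hper w hw) v
  have hint : IntegrableOn (fun z => f (z + (0 : ℝ) • v)) D μ := by
    simpa only [zero_smul, add_zero] using integrableOn_of_periodic hD hf.continuous hper
  have hline (z : E) (t : ℝ) :
      HasDerivAt (fun t : ℝ => f (z + t • v)) (fderiv ℝ f (z + t • v) v) t := by
    have h : HasDerivAt (fun t : ℝ => z + t • v) v t := by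
      simpa only [id, one_smul] using ((hasDerivAt_id t).smul_const v).const_add z
    exact (hf.differentiable one_ne_zero _).hasFDerivAt.comp_hasDerivAt t h
  simpa only [zero_smul, add_zero] using
    (hasDerivAt_integral_of_dominated_loc_of_deriv_le (F := fun t z => f (z + t • v))
      (F' := fun t z => fderiv ℝ f (z + t • v) v) (bound := fun _ => C) Filter.univ_mem
      (.of_forall fun t => (hf.continuous.comp (by fun_prop)).aestronglyMeasurable) hint
      (hcont'.comp (by fun_prop : Continuous fun z : E => z + (0 : ℝ) • v)).aestronglyMeasurable
      (.of_forall fun _ _ _ => hC _) (integrableOn_const hD)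
      (.of_forall fun z t _ => hline z t)).2

theorem setIntegral_fderiv_eq_zero_of_periodic [μ.IsAddLeftInvariant]
    (hD : IsAddFundamentalDomain L D μ) (hDfin : μ D ≠ ⊤) {f : E → F} (hf : ContDiff ℝ 1 f)
    (hper : ∀ w ∈ L, Function.Periodic f w) (v : E) : ∫ z in D, fderiv ℝ f z v ∂μ = 0 := by
  have h := hasDerivAt_setIntegral_comp_add_smul hDfin hf hper v
  simp only [setIntegral_comp_add_right_of_periodic hD hper] at h
  exact h.unique (hasDerivAt_const _ _)

theorem setIntegral_sum_fderiv_eq_zero_of_periodic [μ.IsAddLeftInvariant]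
    (hD : IsAddFundamentalDomain L D μ) (hDfin : μ D ≠ ⊤) {ι : Type*} (s : Finset ι)
    {f : ι → E → F} (hf : ∀ i ∈ s, ContDiff ℝ 1 (f i))
    (hper : ∀ i ∈ s, ∀ w ∈ L, Function.Periodic (f i) w) (v : ι → E) :
    ∫ z in D, ∑ i ∈ s, fderiv ℝ (f i) z (v i) ∂μ = 0 := by
  have hint : ∀ i ∈ s, IntegrableOn (fun z => fderiv ℝ (f i) z (v i)) D μ := fun i hi =>
    integrableOn_of_periodic hDfin
      (((hf i hi).continuous_fderiv one_ne_zero).clm_apply continuous_const)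
      fun w hw => periodic_fderiv_apply (hper i hi w hw) (v i)
  rw [integral_finsetSum s hint]
  exact Finset.sum_eq_zero fun i hi =>
    setIntegral_fderiv_eq_zero_of_periodic hD hDfin (hf i hi) (hper i hi) (v i)

end Lattice

section Vanishing

variable [NormedSpace ℝ E] [FiniteDimensional ℝ E] {L : Submodule ℤ E} [DiscreteTopology L]
  [IsZLattice ℝ L]

theorem eq_zero_of_eq_sum_fderiv_of_nonneg {ι : Type*} (s : Finset ι) {f : ι → E → ℝ}
    {v : ι → E} {φ : E → ℝ} (hf : ∀ i ∈ s, ContDiff ℝ 1 (f i))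
    (hper : ∀ i ∈ s, ∀ w ∈ L, Function.Periodic (f i) w)
    (hφ : ∀ z, φ z = ∑ i ∈ s, fderiv ℝ (f i) z (v i)) (hnonneg : 0 ≤ φ) : φ = 0 := by
  borelize E
  obtain ⟨D, hD, hDfin⟩ := exists_isAddFundamentalDomain_measure_ne_top Measure.addHaar L
  have hcont : Continuous φ := by
    rw [funext hφ]
    exact continuous_finsetSum s fun i hi =>
      ((hf i hi).continuous_fderiv one_ne_zero).clm_apply continuous_const
  have hφper : ∀ w ∈ L, Function.Periodic φ w := fun w hw z => by
    rw [hφ, hφ]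
    exact Finset.sum_congr rfl fun i hi => periodic_fderiv_apply (hper i hi w hw) (v i) z
  refine eq_zero_of_periodic_of_setIntegral_eq_zero hD hcont hφper
    (integrableOn_of_periodic hDfin hcont hφper) hnonneg ?_
  rw [funext hφ]
  exact setIntegral_sum_fderiv_eq_zero_of_periodic hD hDfin s hf hper v

theorem eq_zero_of_extDeriv_eq_const_of_periodic [NormedSpace ℝ F] [CompleteSpace F] {k : ℕ}
    {η : E → E [⋀^Fin k]→L[ℝ] F} (hη : ContDiff ℝ 1 η) (hper : ∀ w ∈ L, Function.Periodic η w)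
    {κ : E [⋀^Fin (k + 1)]→L[ℝ] F} (h : ∀ z, extDeriv η z = κ) : κ = 0 := by
  ext v
  borelize E
  obtain ⟨D, hD, hDfin⟩ := exists_isAddFundamentalDomain_measure_ne_top Measure.addHaar L
  have := vaddInvariantMeasure_submodule (E := E) Measure.addHaar L
  have hvol : (Measure.addHaar : Measure E).real D ≠ 0 :=
    (measureReal_ne_zero_iff hDfin).2 (hD.measure_ne_zero (NeZero.ne _))
  have hsum (z : E) : κ v =
      ∑ i : Fin (k + 1), fderiv ℝ (η · (i.removeNth v)) z ((-1 : ℤ) ^ (i : ℕ) • v i) := by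
    simp only [← h z, extDeriv_apply (hη.differentiable one_ne_zero z), map_zsmul]
  have hstokes := setIntegral_sum_fderiv_eq_zero_of_periodic hD hDfin Finset.univ
    (fun (i : Fin (k + 1)) _ => contDiff_form_apply hη (i.removeNth v))
    (fun i _ w hw z => by simp only [hper w hw z])
    fun i => (-1 : ℤ) ^ (i : ℕ) • v i
  simp only [← hsum, setIntegral_const] at hstokes
  exact (smul_eq_zero.1 hstokes).resolve_left hvol

end Vanishing

end Periodic

/-! ### Self-dual `2`-forms on the quaternions -/

section TwoForms

variable {R E F : Type*} [CommRing R] [AddCommGroup E] [Module R E] [TopologicalSpace E]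
  [AddCommGroup F] [Module R F] [TopologicalSpace F]

theorem twoForm_swap (α : E [⋀^Fin 2]→L[R] F) (u v : E) : α ![u, v] = -α ![v, u] := by
  have hswap : ![u, v] = ![v, u] ∘ Equiv.swap (0 : Fin 2) 1 := by
    ext i
    fin_cases i <;> rfl
  rw [hswap]
  exact α.toAlternatingMap.map_swap ![v, u] (by decide)

theorem twoForm_self (α : E [⋀^Fin 2]→L[R] F) (u : E) : α ![u, u] = 0 :=
  α.map_eq_zero_of_eq _ (i := 0) (j := 1) rfl (by decide)

theorem twoForm_neg_left (α : E [⋀^Fin 2]→L[R] F) (u v : E) : α ![-u, v] = -α ![u, v] := by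
  simpa only [neg_one_smul] using α.vecCons_smul ![v] (-1) u

end TwoForms

@[simp] theorem re_frame (a : Fin 4) : (frame a).re = if a = 0 then 1 else 0 := by
  fin_cases a <;> rfl

@[simp] theorem imI_frame (a : Fin 4) : (frame a).imI = if a = 1 then 1 else 0 := by
  fin_cases a <;> rfl

@[simp] theorem imJ_frame (a : Fin 4) : (frame a).imJ = if a = 2 then 1 else 0 := by
  fin_cases a <;> rfl

@[simp] theorem imK_frame (a : Fin 4) : (frame a).imK = if a = 3 then 1 else 0 := by
  fin_cases a <;> rfl

theorem eq_sum_smul_frame (u : ℍ[ℝ]) :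
    u = u.re • frame 0 + u.imI • frame 1 + u.imJ • frame 2 + u.imK • frame 3 := by
  ext <;> simp

theorem inner_frame (a b : Fin 4) : inner ℝ (frame a) (frame b) = if a = b then (1 : ℝ) else 0 := by
  simp only [Quaternion.inner_def, Quaternion.re_mul, Quaternion.re_star, Quaternion.imI_star,
    Quaternion.imJ_star, Quaternion.imK_star, re_frame, imI_frame, imJ_frame, imK_frame]
  fin_cases a <;> fin_cases b <;> simp

theorem orthonormal_frame : Orthonormal ℝ frame :=
  orthonormal_iff_ite.2 inner_frame

theorem form_eq_zero_of_frame {k : ℕ} {α : ℍ[ℝ] [⋀^Fin k]→L[ℝ] ℝ}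
    (h : ∀ a : Fin k → Fin 4, α (fun i => frame (a i)) = 0) : α = 0 := by
  have hcard : Fintype.card (Fin 4) = Module.finrank ℝ ℍ[ℝ] := by
    rw [Fintype.card_fin, Quaternion.finrank_eq_four]
  refine ContinuousAlternatingMap.toAlternatingMap_injective <|
    (basisOfOrthonormalOfCardEqFinrank orthonormal_frame hcard).ext_alternating fun a _ => ?_
  simpa only [coe_basisOfOrthonormalOfCardEqFinrank] using! h a

theorem twoForm_apply_eq_sum_frame_left (α : ℍ[ℝ] [⋀^Fin 2]→L[ℝ] ℝ) (u v : ℍ[ℝ]) :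
    α ![u, v] = u.re * α ![frame 0, v] + u.imI * α ![frame 1, v] + u.imJ * α ![frame 2, v]
      + u.imK * α ![frame 3, v] := by
  conv_lhs => rw [eq_sum_smul_frame u]
  simp only [ContinuousAlternatingMap.vecCons_add, ContinuousAlternatingMap.vecCons_smul,
    smul_eq_mul]

theorem twoForm_apply (α : ℍ[ℝ] [⋀^Fin 2]→L[ℝ] ℝ) (u v : ℍ[ℝ]) : α ![u, v] =
    α ![frame 0, frame 1] * (u.re * v.imI - u.imI * v.re)
    + α ![frame 0, frame 2] * (u.re * v.imJ - u.imJ * v.re)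
    + α ![frame 0, frame 3] * (u.re * v.imK - u.imK * v.re)
    + α ![frame 1, frame 2] * (u.imI * v.imJ - u.imJ * v.imI)
    + α ![frame 1, frame 3] * (u.imI * v.imK - u.imK * v.imI)
    + α ![frame 2, frame 3] * (u.imJ * v.imK - u.imK * v.imJ) := by
  have hright (a : Fin 4) : α ![frame a, v] = v.re * α ![frame a, frame 0]
      + v.imI * α ![frame a, frame 1] + v.imJ * α ![frame a, frame 2]
      + v.imK * α ![frame a, frame 3] := by
    rw [twoForm_swap, twoForm_apply_eq_sum_frame_left]
    simp only [twoForm_swap α _ (frame a)]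
    ring
  rw [twoForm_apply_eq_sum_frame_left]
  simp only [hright, twoForm_self, twoForm_swap α (frame 1) (frame 0),
    twoForm_swap α (frame 2) (frame 0), twoForm_swap α (frame 3) (frame 0),
    twoForm_swap α (frame 2) (frame 1), twoForm_swap α (frame 3) (frame 1),
    twoForm_swap α (frame 3) (frame 2)]
  ring

theorem innerTwo_apply (α β : ℍ[ℝ] [⋀^Fin 2]→L[ℝ] ℝ) : innerTwo α β =
    α ![frame 0, frame 1] * β ![frame 0, frame 1] + α ![frame 0, frame 2] * β ![frame 0, frame 2]
    + α ![frame 0, frame 3] * β ![frame 0, frame 3] + α ![frame 1, frame 2] * β ![frame 1, frame 2]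
    + α ![frame 1, frame 3] * β ![frame 1, frame 3]
    + α ![frame 2, frame 3] * β ![frame 2, frame 3] := by
  have h0 : Finset.Ioi (0 : Fin 4) = {1, 2, 3} := rfl
  have h1 : Finset.Ioi (1 : Fin 4) = {2, 3} := rfl
  have h2 : Finset.Ioi (2 : Fin 4) = {3} := rfl
  have h3 : Finset.Ioi (3 : Fin 4) = ∅ := rfl
  rw [innerTwo, Fin.sum_univ_four, h0, h1, h2, h3]
  simp only [Finset.mem_insert, Fin.reduceEq, Finset.mem_singleton, or_self, not_false_eq_true,
    Finset.sum_insert, Finset.sum_singleton, Finset.sum_empty, add_zero]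
  ring

theorem omegaV_apply (u v : ℍ[ℝ]) : omegaV ![u, v] =
    -u.imI * v.re + u.re * v.imI + u.imK * v.imJ - u.imJ * v.imK := by
  change inner ℝ (u * qi) v = _
  have hqi : qi = frame 1 := rfl
  simp [Quaternion.inner_def, hqi]

theorem volV_frame : volV frame = -1 := by
  simp only [volV, wedge, omegaV_apply]
  simp

section AlternatizeUncurry

variable {E F : Type*} [NormedAddCommGroup E] [NormedSpace ℝ E] [NormedAddCommGroup F]
  [NormedSpace ℝ F]

theorem alternatizeUncurryFin_one_apply (f : E →L[ℝ] E [⋀^Fin 1]→L[ℝ] F) (u v : E) :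
    ContinuousAlternatingMap.alternatizeUncurryFin f ![u, v] = f u ![v] - f v ![u] := by
  have h1 : (Fin.removeNth 1 ![u, v] : Fin 1 → E) = ![u] := by ext i; fin_cases i; rfl
  simp [ContinuousAlternatingMap.alternatizeUncurryFin_apply, Fin.sum_univ_two, h1,
    sub_eq_add_neg]

theorem alternatizeUncurryFin_two_apply (f : E →L[ℝ] E [⋀^Fin 2]→L[ℝ] F) (u v w : E) :
    ContinuousAlternatingMap.alternatizeUncurryFin f ![u, v, w] =
      f u ![v, w] - f v ![u, w] + f w ![u, v] := by
  have h1 : (Fin.removeNth 1 ![u, v, w] : Fin 2 → E) = ![u, w] := by ext i; fin_cases i <;> rfl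
  have h2 : (Fin.removeNth 2 ![u, v, w] : Fin 2 → E) = ![u, v] := by ext i; fin_cases i <;> rfl
  simp [ContinuousAlternatingMap.alternatizeUncurryFin_apply, Fin.sum_univ_three, h1, h2,
    sub_eq_add_neg]

/-- The wedge product `x ∧ y` of two linear forms. -/
noncomputable def wedgeOne (x y : E →L[ℝ] ℝ) : E [⋀^Fin 2]→L[ℝ] ℝ :=
  ContinuousAlternatingMap.alternatizeUncurryFin
    (x.smulRight (ContinuousAlternatingMap.ofSubsingleton ℝ E ℝ (0 : Fin 1) y))

theorem wedgeOne_apply (x y : E →L[ℝ] ℝ) (u v : E) :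
    wedgeOne x y ![u, v] = x u * y v - x v * y u := by
  rw [wedgeOne, alternatizeUncurryFin_one_apply]
  rfl

end AlternatizeUncurry

theorem leftMul_frame :
    leftMul qi (frame 0) = frame 1 ∧ leftMul qi (frame 1) = -frame 0 ∧
    leftMul qi (frame 2) = frame 3 ∧ leftMul qi (frame 3) = -frame 2 ∧
    leftMul qj (frame 0) = frame 2 ∧ leftMul qj (frame 1) = -frame 3 ∧
    leftMul qj (frame 2) = -frame 0 ∧ leftMul qj (frame 3) = frame 1 ∧
    leftMul qk (frame 0) = frame 3 ∧ leftMul qk (frame 1) = frame 2 ∧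
    leftMul qk (frame 2) = -frame 1 ∧ leftMul qk (frame 3) = -frame 0 := by
  have hmul (q v : ℍ[ℝ]) : leftMul q v = q * v := rfl
  have hi : qi = frame 1 := rfl
  have hj : qj = frame 2 := rfl
  have hk : qk = frame 3 := rfl
  simp only [hmul, hi, hj, hk]
  refine ⟨?_, ?_, ?_, ?_, ?_, ?_, ?_, ?_, ?_, ?_, ?_, ?_⟩ <;>
    ext <;> simp [Quaternion.re_mul, Quaternion.imI_mul, Quaternion.imJ_mul, Quaternion.imK_mul]

/-- The trace `∑_a α(q e_a, e_a)` of a `2`-form against the left multiplication by `q`. For an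
imaginary `q` it is `-2` times the inner product of `α` with the anti-self-dual form
`g_V(q u, v)`. -/
noncomputable def leftTrace (q : ℍ[ℝ]) (α : ℍ[ℝ] [⋀^Fin 2]→L[ℝ] ℝ) : ℝ :=
  ∑ a, α ![leftMul q (frame a), frame a]

/-- The traces of a `2`-form against `I`, `J` and `K`: its coordinates in the three-dimensional
space of anti-self-dual forms. -/
noncomputable def asdTrace (α : ℍ[ℝ] [⋀^Fin 2]→L[ℝ] ℝ) : Fin 3 → ℝ :=
  fun i => leftTrace (![qi, qj, qk] i) α

theorem asdTrace_sub (α β : ℍ[ℝ] [⋀^Fin 2]→L[ℝ] ℝ) :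
    asdTrace (α - β) = asdTrace α - asdTrace β := by
  ext i
  simp only [asdTrace, leftTrace, ContinuousAlternatingMap.sub_apply, Finset.sum_sub_distrib,
    Pi.sub_apply]

theorem asdTrace_apply (α : ℍ[ℝ] [⋀^Fin 2]→L[ℝ] ℝ) : asdTrace α =
    ![-2 * (α ![frame 0, frame 1] + α ![frame 2, frame 3]),
      -2 * (α ![frame 0, frame 2] - α ![frame 1, frame 3]),
      -2 * (α ![frame 0, frame 3] + α ![frame 1, frame 2])] := by
  obtain ⟨hi0, hi1, hi2, hi3, hj0, hj1, hj2, hj3, hk0, hk1, hk2, hk3⟩ := leftMul_frame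
  have hvec : asdTrace α = ![leftTrace qi α, leftTrace qj α, leftTrace qk α] := by
    ext i
    fin_cases i <;> rfl
  simp only [hvec, leftTrace, Fin.sum_univ_four, hi0, hi1, hi2, hi3, hj0, hj1, hj2, hj3,
    hk0, hk1, hk2, hk3, twoForm_neg_left, twoForm_swap α (frame 1) (frame 0),
    twoForm_swap α (frame 2) (frame 0), twoForm_swap α (frame 3) (frame 0),
    twoForm_swap α (frame 2) (frame 1), twoForm_swap α (frame 3) (frame 1),
    twoForm_swap α (frame 3) (frame 2)]
  congr! 1
  · ring
  congr! 1
  · ring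
  congr! 1
  ring

theorem asdTrace_eq_zero_iff (α : ℍ[ℝ] [⋀^Fin 2]→L[ℝ] ℝ) : asdTrace α = 0 ↔
    α ![frame 2, frame 3] = -α ![frame 0, frame 1] ∧
    α ![frame 1, frame 3] = α ![frame 0, frame 2] ∧
    α ![frame 1, frame 2] = -α ![frame 0, frame 3] := by
  simp only [asdTrace_apply, funext_iff, Fin.forall_fin_succ, Matrix.cons_val_zero,
    Matrix.cons_val_succ, Pi.zero_apply, IsEmpty.forall_iff, and_true, mul_eq_zero, neg_eq_zero,
    OfNat.ofNat_ne_zero, false_or]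
  constructor <;> rintro ⟨h1, h2, h3⟩ <;> refine ⟨?_, ?_, ?_⟩ <;> linarith

theorem isHodgeStar_self_of_asdTrace_eq_zero {α : ℍ[ℝ] [⋀^Fin 2]→L[ℝ] ℝ} (h : asdTrace α = 0) :
    IsHodgeStar α α := by
  intro β u
  obtain ⟨h23, h13, h12⟩ := (asdTrace_eq_zero_iff α).1 h
  simp only [innerTwo_apply, volV, wedge, omegaV_apply, twoForm_apply α (u _) (u _),
    twoForm_apply β (u _) (u _), h23, h13, h12]
  ring

theorem isHodgeStar_self_iff {α : ℍ[ℝ] [⋀^Fin 2]→L[ℝ] ℝ} :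
    IsHodgeStar α α ↔ asdTrace α = 0 := by
  refine ⟨fun h => (asdTrace_eq_zero_iff α).2 ?_, isHodgeStar_self_of_asdTrace_eq_zero⟩
  have hframe (a b : Fin 4) := h (wedgeOne (innerSL ℝ (frame a)) (innerSL ℝ (frame b))) frame
  simp only [wedge, innerTwo_apply, wedgeOne_apply, innerSL_apply_apply, inner_frame, volV_frame]
    at hframe
  have h01 := hframe 0 1
  have h02 := hframe 0 2
  have h03 := hframe 0 3
  simp only [reduceIte, mul_one, zero_ne_one, one_ne_zero, mul_zero, sub_zero, one_mul,
    Fin.reduceEq, sub_self, zero_mul, add_zero, mul_neg, zero_sub, zero_add, neg_inj] at h01 h02 h03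
  exact ⟨by linarith, by linarith, by linarith⟩

theorem asdTrace_omegaV : asdTrace omegaV = 0 := by
  simp [asdTrace_eq_zero_iff, omegaV_apply]

/-! ### Exact self-dual forms -/

section FlatForms

theorem minSmoothness_two_le_infty : minSmoothness ℝ 2 ≤ (∞ : ℕ∞ω) := by
  rw [minSmoothness_of_isRCLikeNormedField]
  exact WithTop.coe_le_coe.2 (le_top : (2 : ℕ∞) ≤ ⊤)

theorem codiff_apply {k : ℕ} (η : ℍ[ℝ] → ℍ[ℝ] [⋀^Fin (k + 1)]→L[ℝ] ℝ) (z : ℍ[ℝ])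
    (v : Fin k → ℍ[ℝ]) :
    codiff η z v = -∑ a, fderiv ℝ η z (frame a) (Matrix.vecCons (frame a) v) := by
  simp only [codiff, ContinuousAlternatingMap.neg_apply, ContinuousAlternatingMap.sum_apply,
    ContinuousAlternatingMap.curryLeft_apply_apply]

theorem leftTrace_fderiv {β : ℍ[ℝ] → ℍ[ℝ] [⋀^Fin 2]→L[ℝ] ℝ} {z : ℍ[ℝ]}
    (hβ : DifferentiableAt ℝ β z) (q w : ℍ[ℝ]) :
    leftTrace q (fderiv ℝ β z w) = fderiv ℝ (fun y => leftTrace q (β y)) z w := by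
  simp only [leftTrace]
  rw [fderiv_fun_sum fun a _ => hβ.continuousAlternatingMap_apply_const _, sum_apply]
  exact Finset.sum_congr rfl fun a _ =>
    (fderiv_continuousAlternatingMap_apply_const_apply hβ _ w).symm

theorem asdTrace_fderiv {β : ℍ[ℝ] → ℍ[ℝ] [⋀^Fin 2]→L[ℝ] ℝ} {z : ℍ[ℝ]}
    (hβ : DifferentiableAt ℝ β z) (hsd : ∀ y, asdTrace (β y) = 0) (w : ℍ[ℝ]) :
    asdTrace (fderiv ℝ β z w) = 0 := by
  funext i
  have hconst : (fun y => leftTrace (![qi, qj, qk] i) (β y)) = fun _ => 0 :=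
    funext fun y => congrFun (hsd y) i
  rw [asdTrace, leftTrace_fderiv hβ, hconst, fderiv_const_apply]
  rfl

/-- Read `T a` as the derivative in the direction `e_a` of a self-dual form; `hclosed` then says
that this form is closed, and the conclusion that it is coclosed. -/
theorem sum_apply_frame_eq_zero_of_asdTrace_eq_zero {T : Fin 4 → ℍ[ℝ] [⋀^Fin 2]→L[ℝ] ℝ}
    (hsd : ∀ a, asdTrace (T a) = 0)
    (hclosed : ∀ a b c, T a ![frame b, frame c] - T b ![frame a, frame c]
      + T c ![frame a, frame b] = 0) (b : Fin 4) : ∑ a, T a ![frame a, frame b] = 0 := by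
  simp only [asdTrace_eq_zero_iff, Fin.forall_fin_succ, Fin.succ_zero_eq_one, Fin.succ_one_eq_two,
    Fin.reduceSucc, IsEmpty.forall_iff, and_true] at hsd
  obtain ⟨⟨h0, h0', h0''⟩, ⟨h1, h1', h1''⟩, ⟨h2, h2', h2''⟩, ⟨h3, h3', h3''⟩⟩ := hsd
  have h012 := hclosed 0 1 2
  have h013 := hclosed 0 1 3
  have h023 := hclosed 0 2 3
  have h123 := hclosed 1 2 3
  rw [Fin.sum_univ_four]
  fin_cases b <;>
    simp only [Fin.zero_eta, Fin.mk_one, Fin.reduceFinMk, twoForm_self,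
      twoForm_swap _ (frame 1) (frame 0), twoForm_swap _ (frame 2) (frame 0),
      twoForm_swap _ (frame 3) (frame 0), twoForm_swap _ (frame 2) (frame 1),
      twoForm_swap _ (frame 3) (frame 1), twoForm_swap _ (frame 3) (frame 2)] <;>
    linarith

theorem codiff_eq_zero_of_asdTrace_eq_zero {β : ℍ[ℝ] → ℍ[ℝ] [⋀^Fin 2]→L[ℝ] ℝ}
    (hβ : Differentiable ℝ β) (hsd : ∀ z, asdTrace (β z) = 0) (hclosed : extDeriv β = 0) :
    codiff (k := 1) β = 0 := by
  funext z
  refine form_eq_zero_of_frame fun b => ?_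
  have hb : (fun i => frame (b i)) = ![frame (b 0)] := List.ofFn_inj.1 rfl
  rw [codiff_apply, hb, neg_eq_zero]
  refine sum_apply_frame_eq_zero_of_asdTrace_eq_zero (fun a => asdTrace_fderiv (hβ z) hsd (frame a))
    (fun a b c => ?_) (b 0)
  rw [← alternatizeUncurryFin_two_apply, ← extDeriv, hclosed]
  rfl

end FlatForms

section PeriodicForms

/-- The summation by parts `∑_{a,b} (dη_ab)² = 2 ∑_{a,b} ∂_a (η_b dη_ab)`. -/
theorem sum_sq_extDeriv_eq_sum_fderiv {η : ℍ[ℝ] → ℍ[ℝ] [⋀^Fin 1]→L[ℝ] ℝ} (hη : ContDiff ℝ ∞ η)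
    (hco : codiff (k := 1) (extDeriv η) = 0) (z : ℍ[ℝ]) :
    ∑ p : Fin 4 × Fin 4, extDeriv η z ![frame p.1, frame p.2] ^ 2 =
      ∑ p : Fin 4 × Fin 4, fderiv ℝ (fun y => 2 * (η y ![frame p.2]
        * extDeriv η y ![frame p.1, frame p.2])) z (frame p.1) := by
  have hηd : DifferentiableAt ℝ η z := hη.differentiable (by simp) z
  have hβd : DifferentiableAt ℝ (extDeriv η) z :=
    (contDiff_extDeriv hη (m := ∞) (by simp)).differentiable (by simp) z
  have hprod (a b : Fin 4) : fderiv ℝ (fun y => 2 * (η y ![frame b]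
      * extDeriv η y ![frame a, frame b])) z (frame a) =
      2 * (η z ![frame b] * fderiv ℝ (extDeriv η) z (frame a) ![frame a, frame b])
      + 2 * (extDeriv η z ![frame a, frame b] * fderiv ℝ η z (frame a) ![frame b]) := by
    have h1 := hηd.continuousAlternatingMap_apply_const ![frame b]
    have h2 := hβd.continuousAlternatingMap_apply_const ![frame a, frame b]
    rw [fderiv_const_mul (h1.fun_mul h2), fderiv_fun_mul h1 h2, smul_apply, add_apply, smul_apply,
      smul_apply, fderiv_continuousAlternatingMap_apply_const_apply hηd,
      fderiv_continuousAlternatingMap_apply_const_apply hβd, smul_eq_mul, smul_eq_mul, smul_eq_mul,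
      mul_add]
  have hdiv (b : Fin 4) : ∑ a, fderiv ℝ (extDeriv η) z (frame a) ![frame a, frame b] = 0 := by
    rw [← neg_eq_zero, ← codiff_apply, hco]
    rfl
  have hdη (a b : Fin 4) : extDeriv η z ![frame a, frame b] =
      fderiv ℝ η z (frame a) ![frame b] - fderiv ℝ η z (frame b) ![frame a] := by
    rw [extDeriv, alternatizeUncurryFin_one_apply]
  simp only [Fintype.sum_prod_type, hprod, Finset.sum_add_distrib]
  rw [Finset.sum_comm (f := fun a b => 2 * (η z ![frame b] * _))]
  simp only [← Finset.mul_sum, hdiv, mul_zero, Finset.sum_const_zero, zero_add]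
  simp only [hdη, Fin.sum_univ_four]
  ring

variable {Γ : Submodule ℤ ℍ[ℝ]} [DiscreteTopology Γ] [IsZLattice ℝ Γ]
  {η : ℍ[ℝ] → ℍ[ℝ] [⋀^Fin 1]→L[ℝ] ℝ} (hη : ContDiff ℝ ∞ η)
  (hper : ∀ w ∈ Γ, Function.Periodic η w)
include hη hper

theorem extDeriv_eq_zero_of_periodic_of_codiff_eq_zero
    (hco : codiff (k := 1) (extDeriv η) = 0) : extDeriv η = 0 := by
  have hηp (v : Fin 1 → ℍ[ℝ]) : ContDiff ℝ 1 fun z => η z v :=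
    contDiff_form_apply (hη.of_le (by simp)) v
  have hdηp (v : Fin 2 → ℍ[ℝ]) : ContDiff ℝ 1 fun z => extDeriv η z v :=
    contDiff_form_apply ((contDiff_extDeriv hη (m := ∞) (by simp)).of_le (by simp)) v
  have hzero := eq_zero_of_eq_sum_fderiv_of_nonneg (L := Γ) Finset.univ
    (fun p _ => contDiff_const.mul ((hηp _).mul (hdηp _)))
    (fun p _ w hw z => by simp only [hper w hw z, periodic_extDeriv (hper w hw) z])
    (sum_sq_extDeriv_eq_sum_fderiv hη hco) fun z => Finset.sum_nonneg fun p _ => sq_nonneg _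
  funext z
  refine form_eq_zero_of_frame fun a => ?_
  have ha : (fun i => frame (a i)) = ![frame (a 0), frame (a 1)] := List.ofFn_inj.1 rfl
  rw [ha, ← sq_eq_zero_iff]
  exact (Finset.sum_eq_zero_iff_of_nonneg fun p _ => sq_nonneg _).1 (congrFun hzero z) (a 0, a 1)
    (Finset.mem_univ _)

theorem extDeriv_eq_zero_of_periodic_of_asdTrace_eq_zero
    (hsd : ∀ z, asdTrace (extDeriv η z) = 0) : extDeriv η = 0 :=
  extDeriv_eq_zero_of_periodic_of_codiff_eq_zero hη hper <|
    codiff_eq_zero_of_asdTrace_eq_zero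
      ((contDiff_extDeriv hη (m := ∞) (by simp)).differentiable (by simp)) hsd
      (extDeriv_extDeriv hη minSmoothness_two_le_infty)

end PeriodicForms

/-! ### Lifts to the universal covering -/

section Lifts

variable {Γ : Submodule ℤ ℍ[ℝ]}

theorem proj_add_of_mem (z : ℍ[ℝ]) {w : ℍ[ℝ]} (hw : w ∈ Γ) : proj Γ (z + w) = proj Γ z :=
  (proj_eq_iff Γ).2 (by rwa [sub_add_cancel_left, neg_mem_iff])

theorem exists_comp_proj_eq {X : Type*} {g : ℍ[ℝ] → X} (hg : ∀ w ∈ Γ, Function.Periodic g w) :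
    ∃ f : Torus Γ → X, ∀ z, f (proj Γ z) = g z := by
  have hsec := Function.surjInv_eq (proj_surjective Γ)
  refine ⟨g ∘ Function.surjInv (proj_surjective Γ), fun z => ?_⟩
  rw [Function.comp_apply, ← hg _ ((proj_eq_iff Γ).1 (hsec (proj Γ z))), add_sub_cancel]

variable [DiscreteTopology Γ]

theorem mfderiv_proj (z : ℍ[ℝ]) : mfderiv 𝓘(ℝ, ℍ[ℝ]) 𝓘(ℝ, ℍ[ℝ]) (proj Γ) z =
    ((rho (proj Γ z)).symm : ℍ[ℝ] →L[ℝ] _) := by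
  exact ContinuousLinearMap.ext fun v => rho_mfderiv_proj z v

namespace Form

variable {k : ℕ}

theorem lift_eq (α : Form Γ k) (z : ℍ[ℝ]) : α.lift z =
    (α (proj Γ z)).compContinuousLinearMap ((rho (proj Γ z)).symm : ℍ[ℝ] →L[ℝ] _) := by
  rw [Form.lift, mfderiv_proj]

theorem periodic_lift (α : Form Γ k) {w : ℍ[ℝ]} (hw : w ∈ Γ) : Function.Periodic α.lift w :=
  fun z => by rw [lift_eq, lift_eq, proj_add_of_mem z hw]

theorem lift_injective : Function.Injective (Form.lift : Form Γ k → _) := fun α β h => by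
  funext x
  obtain ⟨z, rfl⟩ := proj_surjective Γ x
  have hz := congrFun h z
  rwa [lift_eq, lift_eq] at hz

theorem exists_lift_eq {e : ℍ[ℝ] → ℍ[ℝ] [⋀^Fin k]→L[ℝ] ℝ}
    (he : ∀ w ∈ Γ, Function.Periodic e w) : ∃ α : Form Γ k, α.lift = e := by
  obtain ⟨ε, hε⟩ := exists_comp_proj_eq he
  refine ⟨fun x => (ε x).compContinuousLinearMap (rho x : _ →L[ℝ] ℍ[ℝ]), funext fun z => ?_⟩
  rw [lift_eq, hε]
  rfl

theorem isSelfDual_iff (α : Form Γ 2) : α.IsSelfDual ↔ ∀ z, asdTrace (α.lift z) = 0 := by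
  simp only [IsSelfDual, (proj_surjective Γ).forall, isHodgeStar_self_iff, lift_eq]

theorem lift_omegaM (z : ℍ[ℝ]) : (omegaM Γ).lift z = omegaV := by
  rw [lift_eq]
  rfl

end Form

variable (Γ) in
theorem isCoveringMap_proj : IsCoveringMap (proj Γ) :=
  (AddSubgroup.isAddQuotientCoveringMap_of_comm Γ.toAddSubgroup
    (by constructor; exact inferInstanceAs (DiscreteTopology Γ))).isCoveringMap

/-- `F` is a smooth lift of `f` to the universal covering. -/
structure IsSmoothLift (f : Torus Γ → Torus Γ) (F : ℍ[ℝ] → ℍ[ℝ]) : Prop where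
  contDiff : ContDiff ℝ ∞ F
  proj_apply : ∀ z, proj Γ (F z) = f (proj Γ z)

theorem contMDiffAt_chartAt (x : Torus Γ) :
    ContMDiffAt 𝓘(ℝ, ℍ[ℝ]) 𝓘(ℝ, ℍ[ℝ]) ∞ (chartAt ℍ[ℝ] x) x :=
  contMDiffOn_chart.contMDiffAt
    ((chartAt ℍ[ℝ] x).open_source.mem_nhds (mem_chart_source ℍ[ℝ] x))

theorem IsSmoothLift.of_continuous (f : SmoothMap Γ) {F : ℍ[ℝ] → ℍ[ℝ]} (hF : Continuous F)
    (h : ∀ z, proj Γ (F z) = f (proj Γ z)) : IsSmoothLift f F := by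
  refine ⟨contDiff_iff_contDiffAt.2 fun z => ?_, h⟩
  obtain ⟨c, hc⟩ := chart_proj (chart_mem_atlas ℍ[ℝ] (f (proj Γ z))) (z := F z)
    (by rw [h]; exact mem_chart_source ℍ[ℝ] _)
  have hchart : ContMDiffAt 𝓘(ℝ, ℍ[ℝ]) 𝓘(ℝ, ℍ[ℝ]) ∞
      (fun y => chartAt ℍ[ℝ] (f (proj Γ z)) (f (proj Γ y))) z :=
    ContMDiffAt.comp z (contMDiffAt_chartAt _) ((f.contMDiff _).comp z (contMDiff_proj z))
  refine (hchart.contDiffAt.sub (contDiffAt_const (c := c))).congr_of_eventuallyEq ?_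
  filter_upwards [hF.continuousAt hc] with y hy
  have hFy : chartAt ℍ[ℝ] (f (proj Γ z)) (proj Γ (F y)) = F y + c := hy
  rw [← h y, hFy, add_sub_cancel_right]

theorem exists_isSmoothLift (f : SmoothMap Γ) : ∃ F, IsSmoothLift f F := by
  obtain ⟨w, hw⟩ := proj_surjective Γ (f (proj Γ 0))
  obtain ⟨F, ⟨-, hF⟩, -⟩ := (isCoveringMap_proj Γ).existsUnique_continuousMap_lifts
    (⟨fun z => f (proj Γ z), f.contMDiff.continuous.comp contMDiff_proj.continuous⟩ :
      C(ℍ[ℝ], Torus Γ)) 0 w hw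
  exact ⟨F, .of_continuous f F.continuous fun z => congrFun hF z⟩

theorem exists_smoothMap_of_lift {F : ℍ[ℝ] → ℍ[ℝ]} (hF : ContDiff ℝ ∞ F)
    (h : ∀ w ∈ Γ, Function.Periodic (proj Γ ∘ F) w) : ∃ f : SmoothMap Γ, IsSmoothLift f F := by
  obtain ⟨f, hf⟩ := exists_comp_proj_eq h
  refine ⟨⟨f, fun x => ?_⟩, hF, fun z => (hf z).symm⟩
  have hcomp : ContMDiffAt 𝓘(ℝ, ℍ[ℝ]) 𝓘(ℝ, ℍ[ℝ]) ∞ (fun y => proj Γ (F (chartAt ℍ[ℝ] x y))) x :=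
    (contMDiff_proj _).comp x (ContMDiffAt.comp x (hF.contMDiff _) (contMDiffAt_chartAt x))
  refine hcomp.congr_of_eventuallyEq ?_
  filter_upwards [(chartAt ℍ[ℝ] x).open_source.mem_nhds (mem_chart_source ℍ[ℝ] x)] with y hy
  have hy' : proj Γ (chartAt ℍ[ℝ] x y) = y := by
    rw [← proj_chart (chart_mem_atlas ℍ[ℝ] x), (chartAt ℍ[ℝ] x).left_inv hy]
  rw [← Function.comp_apply (f := proj Γ), ← hf, hy']

namespace IsSmoothLift

variable {f : SmoothMap Γ} {F : ℍ[ℝ] → ℍ[ℝ]}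

theorem mfderiv_comp_eq (h : IsSmoothLift f F) (z : ℍ[ℝ]) :
    (rho (f (proj Γ z)) : _ →L[ℝ] ℍ[ℝ]).comp
      ((mfderiv 𝓘(ℝ, ℍ[ℝ]) 𝓘(ℝ, ℍ[ℝ]) f (proj Γ z)).comp
        ((rho (proj Γ z)).symm : ℍ[ℝ] →L[ℝ] _)) = fderiv ℝ F z := by
  have hp (y : ℍ[ℝ]) : MDifferentiableAt 𝓘(ℝ, ℍ[ℝ]) 𝓘(ℝ, ℍ[ℝ]) (proj Γ) y :=
    (contMDiff_proj y).mdifferentiableAt (by simp)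
  have hf : MDifferentiableAt 𝓘(ℝ, ℍ[ℝ]) 𝓘(ℝ, ℍ[ℝ]) f (proj Γ z) :=
    (f.contMDiff _).mdifferentiableAt (by simp)
  have hF : MDifferentiableAt 𝓘(ℝ, ℍ[ℝ]) 𝓘(ℝ, ℍ[ℝ]) F z :=
    (h.contDiff.differentiable (by simp) z).mdifferentiableAt
  have hchain := mfderiv_comp z hf (hp z)
  rw [← funext h.proj_apply (f := proj Γ ∘ F) (g := f ∘ proj Γ), mfderiv_comp z (hp (F z)) hF,
    mfderiv_proj, mfderiv_proj, mfderiv_eq_fderiv] at hchain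
  exact hchain.symm

theorem lift_pullback_omegaM (h : IsSmoothLift f F) (z : ℍ[ℝ]) :
    ((omegaM Γ).pullback f).lift z = omegaV.compContinuousLinearMap (fderiv ℝ F z) := by
  rw [Form.lift_eq, ← h.mfderiv_comp_eq]
  rfl

end IsSmoothLift

theorem momentMap_differential (f : SmoothMap Γ) (q z : ℍ[ℝ]) :
    momentMap (leftMul q) (differential f) (proj Γ z) =
      1 / 2 * leftTrace q (((omegaM Γ).pullback f).lift z) := by
  have hterm (a : Fin 4) :
      inner ℝ (involution (leftMul q) (differential f) (proj Γ z) ((rho (proj Γ z)).symm (frame a)))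
        (differential f (proj Γ z) ((rho (proj Γ z)).symm (frame a))) =
      -((omegaM Γ).pullback f).lift z ![leftMul q (frame a), frame a] := by
    have hform : ((omegaM Γ).pullback f).lift z ![leftMul q (frame a), frame a] = inner ℝ
        (rightI (differential f (proj Γ z) ((rho (proj Γ z)).symm (leftMul q (frame a)))))
        (differential f (proj Γ z) ((rho (proj Γ z)).symm (frame a))) := by
      rw [Form.lift_eq]
      rfl
    rw [hform, ← inner_neg_left, ← map_neg]
    rfl
  simp only [momentMap, innerOne, hterm, leftTrace, Finset.sum_neg_distrib]
  ring

theorem hyperMomentMap_eq_zero_iff (f : SmoothMap Γ) :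
    hyperMomentMap (differential f) = 0 ↔ ((omegaM Γ).pullback f).IsSelfDual := by
  have hμ : hyperMomentMap (differential f) =
      fun i => momentMap (leftMul (![qi, qj, qk] i)) (differential f) := by
    funext i
    fin_cases i <;> rfl
  simp only [hμ, Form.isSelfDual_iff, funext_iff, (proj_surjective Γ).forall,
    momentMap_differential, asdTrace, Pi.zero_apply, mul_eq_zero, one_div, inv_eq_zero,
    OfNat.ofNat_ne_zero, false_or]
  exact forall_comm

end Lifts

/-! ### Lattices and linear maps -/

section Determinant

theorem det_sq_eq_one_of_comp_eq {K V : Type*} [Field K] [AddCommGroup V] [Module K V]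
    [FiniteDimensional K V] {B : LinearMap.BilinForm K V} (hB : B.Nondegenerate) {A : V →ₗ[K] V}
    (h : B.comp A A = B) : LinearMap.det A ^ 2 = 1 := by
  classical
  let b := Module.finBasis K V
  have hdet := congrArg (fun B' => (LinearMap.BilinForm.toMatrix b B').det) h
  simp only [LinearMap.BilinForm.toMatrix_comp b, Matrix.det_mul, Matrix.det_transpose,
    LinearMap.det_toMatrix] at hdet
  refine mul_right_cancel₀ ((LinearMap.BilinForm.nondegenerate_iff_det_ne_zero b).1 hB) ?_
  linear_combination hdet

variable {E : Type*} [NormedAddCommGroup E] [NormedSpace ℝ E] [FiniteDimensional ℝ E]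
  {L : Submodule ℤ E} [DiscreteTopology L] [IsZLattice ℝ L]

theorem cast_det_restrict {A : E →ₗ[ℝ] E} (hA : ∀ w ∈ L, A w ∈ L) :
    ((LinearMap.det ((A.restrictScalars ℤ).restrict hA) : ℤ) : ℝ) = LinearMap.det A := by
  classical
  have := ZLattice.module_free ℝ L
  have := ZLattice.module_finite ℝ L
  let b := Module.Free.chooseBasis ℤ L
  let bR := b.ofZLatticeBasis ℝ L
  have hmatrix : LinearMap.toMatrix bR bR A = (Int.castRingHom ℝ).mapMatrix
      (LinearMap.toMatrix b b ((A.restrictScalars ℤ).restrict hA)) := by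
    ext i j
    have hcol : A (bR j) = ((A.restrictScalars ℤ).restrict hA (b j) : L) := by
      rw [Module.Basis.ofZLatticeBasis_apply]
      rfl
    rw [LinearMap.toMatrix_apply, hcol, Module.Basis.ofZLatticeBasis_repr_apply,
      RingHom.mapMatrix_apply, Matrix.map_apply, LinearMap.toMatrix_apply, eq_intCast]
  rw [← LinearMap.det_toMatrix bR, hmatrix, ← RingHom.map_det, LinearMap.det_toMatrix, eq_intCast]

theorem surjOn_lattice_of_comp_eq {A : E →ₗ[ℝ] E} (hA : Set.MapsTo A L L)
    {B : LinearMap.BilinForm ℝ E} (hB : B.Nondegenerate) (h : B.comp A A = B) :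
    Set.SurjOn A L L := fun w hw => by
  have := ZLattice.module_free ℝ L
  have := ZLattice.module_finite ℝ L
  have hsq := det_sq_eq_one_of_comp_eq hB h
  rw [← cast_det_restrict hA] at hsq
  have hunit : IsUnit (LinearMap.det ((A.restrictScalars ℤ).restrict hA)) :=
    .of_pow_eq_one (mod_cast hsq) two_ne_zero
  obtain ⟨x, hx⟩ := ((Module.End.isUnit_iff _).1
    ((LinearMap.isUnit_iff_isUnit_det _).2 hunit)).2 ⟨w, hw⟩
  exact ⟨x, x.2, congrArg Subtype.val hx⟩

theorem exists_linearMap_apply_lattice {F : Type*} [AddCommGroup F] [Module ℝ F] (a : L →+ F) :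
    ∃ A : E →ₗ[ℝ] F, ∀ w : L, A w = a w := by
  have := ZLattice.module_free ℝ L
  let b := Module.Free.chooseBasis ℤ L
  let A := (b.ofZLatticeBasis ℝ L).constr ℝ fun i => a (b i)
  have hbasis : (A.restrictScalars ℤ).comp L.subtype = a.toIntLinearMap := b.ext fun i => by
    have hi : A (b.ofZLatticeBasis ℝ L i) = a (b i) := Module.Basis.constr_basis _ _ _ _
    rwa [Module.Basis.ofZLatticeBasis_apply] at hi
  exact ⟨A, LinearMap.congr_fun hbasis⟩

end Determinant

section Symplectic

/-- An endomorphism `B` of `ℍ` is symplectic: `B^* ω_V = ω_V`. -/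
def IsSymplecticLinear (B : ℍ[ℝ] →L[ℝ] ℍ[ℝ]) : Prop :=
  omegaV.compContinuousLinearMap B = omegaV

/-- The symplectic form `ω_V` as a bilinear form. -/
noncomputable def omegaBilin : LinearMap.BilinForm ℝ ℍ[ℝ] :=
  (innerₗ ℍ[ℝ]).comp (rightI : ℍ[ℝ] →ₗ[ℝ] ℍ[ℝ])

theorem inner_rightI_swap (u v : ℍ[ℝ]) : inner ℝ (rightI u) v = -inner ℝ (rightI v) u :=
  twoForm_swap omegaV u v

theorem rightI_injective : Function.Injective rightI := by
  have hqi : qi ≠ 0 := fun h => one_ne_zero (congrArg QuaternionAlgebra.imI h)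
  exact mul_left_injective₀ hqi

theorem omegaBilin_nondegenerate : omegaBilin.Nondegenerate := by
  have hleft (u) (hu : ∀ v, omegaBilin u v = 0) : u = 0 :=
    (map_eq_zero_iff _ rightI_injective).1 (inner_self_eq_zero.1 (hu (rightI u)))
  refine ⟨hleft, fun u hu => hleft u fun v => ?_⟩
  exact (inner_rightI_swap u v).trans (neg_eq_zero.2 (hu v))

theorem IsSymplecticLinear.omegaBilin_comp_eq {B : ℍ[ℝ] →L[ℝ] ℍ[ℝ]} (h : IsSymplecticLinear B) :
    omegaBilin.comp (B : ℍ[ℝ] →ₗ[ℝ] ℍ[ℝ]) (B : ℍ[ℝ] →ₗ[ℝ] ℍ[ℝ]) = omegaBilin := by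
  ext u v
  exact DFunLike.congr_fun h ![u, v]

theorem IsSymplecticLinear.exists_continuousLinearEquiv {B : ℍ[ℝ] →L[ℝ] ℍ[ℝ]}
    (h : IsSymplecticLinear B) : ∃ e : ℍ[ℝ] ≃L[ℝ] ℍ[ℝ], (e : ℍ[ℝ] →L[ℝ] ℍ[ℝ]) = B := by
  have hdet : B.det ≠ 0 := fun h0 => by
    have hsq := det_sq_eq_one_of_comp_eq omegaBilin_nondegenerate h.omegaBilin_comp_eq
    change B.det ^ 2 = 1 at hsq
    simp [h0] at hsq
  exact ⟨B.toContinuousLinearEquivOfDetNeZero hdet, B.coe_toContinuousLinearEquivOfDetNeZero hdet⟩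

end Symplectic

/-! ### The linear part of a map of the torus -/

section LinearPart

theorem eq_of_continuous_of_mem_discrete {X Y : Type*} [TopologicalSpace X] [PreconnectedSpace X]
    [TopologicalSpace Y] {s : Set Y} [DiscreteTopology s] {g : X → Y} (hg : Continuous g)
    (h : ∀ x, g x ∈ s) (x y : X) : g x = g y :=
  congrArg Subtype.val (PreconnectedSpace.constant ‹_›
    (f := fun x => (⟨g x, h x⟩ : s)) (hg.subtype_mk h) (x := x) (y := y))

variable {Γ : Submodule ℤ ℍ[ℝ]} [DiscreteTopology Γ]

/-- `F` is a smooth lift of `f` and `A` is the linear map which `f` induces on the universal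
covering through its action on the fundamental group `Γ`. -/
structure IsEquivariantLift (f : Torus Γ → Torus Γ) (F : ℍ[ℝ] → ℍ[ℝ]) (A : ℍ[ℝ] →L[ℝ] ℍ[ℝ]) : Prop
    extends IsSmoothLift f F where
  map_mem : ∀ w ∈ Γ, A w ∈ Γ
  add_mem : ∀ z, ∀ w ∈ Γ, F (z + w) = F z + A w

theorem IsSmoothLift.exists_isEquivariantLift [IsZLattice ℝ Γ] {f : Torus Γ → Torus Γ}
    {F : ℍ[ℝ] → ℍ[ℝ]} (h : IsSmoothLift f F) : ∃ A, IsEquivariantLift f F A := by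
  have hmem {w : ℍ[ℝ]} (hw : w ∈ Γ) (z : ℍ[ℝ]) : F (z + w) - F z ∈ Γ := by
    rw [← proj_eq_iff, h.proj_apply, h.proj_apply, proj_add_of_mem z hw]
  have hconst {w : ℍ[ℝ]} (hw : w ∈ Γ) (z : ℍ[ℝ]) : F (z + w) - F z = F w - F 0 := by
    have hcont := h.contDiff.continuous
    have : DiscreteTopology (Γ : Set ℍ[ℝ]) := ‹DiscreteTopology Γ›
    have := eq_of_continuous_of_mem_discrete (s := Γ) (g := fun z => F (z + w) - F z)
      (by fun_prop) (hmem hw) z 0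
    rwa [zero_add] at this
  let a : Γ →+ ℍ[ℝ] := AddMonoidHom.mk' (fun w => F w - F 0) fun w w' => by
    rw [Submodule.coe_add, ← hconst w'.2 w, add_comm, sub_add_sub_cancel']
  obtain ⟨A, hA⟩ := exists_linearMap_apply_lattice a
  have hA' {w : ℍ[ℝ]} (hw : w ∈ Γ) : A w = F w - F 0 := hA ⟨w, hw⟩
  refine ⟨LinearMap.toContinuousLinearMap A, h, fun w hw => ?_, fun z w hw => ?_⟩
  · rw [LinearMap.coe_toContinuousLinearMap', hA' hw, ← hconst hw 0]
    exact hmem hw 0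
  · rw [LinearMap.coe_toContinuousLinearMap', hA' hw, ← hconst hw z, add_sub_cancel]

theorem exists_isEquivariantLift [IsZLattice ℝ Γ] (f : SmoothMap Γ) :
    ∃ F A, IsEquivariantLift f F A :=
  (exists_isSmoothLift f).imp fun _ hF => hF.exists_isEquivariantLift

end LinearPart

/-! ### The cohomology class of the pullback of the symplectic form -/

section Primitive

/-- The `1`-form `v ↦ ω_V(u, (A + du / 2) v)`, a primitive of `(A + u)^* ω_V - A^* ω_V`. -/
noncomputable def primitive (A : ℍ[ℝ] →L[ℝ] ℍ[ℝ]) (u : ℍ[ℝ] → ℍ[ℝ]) (z : ℍ[ℝ]) :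
    ℍ[ℝ] [⋀^Fin 1]→L[ℝ] ℝ :=
  ContinuousAlternatingMap.ofSubsingletonLIE (0 : Fin 1)
    ((innerSL ℝ (rightI (u z))).comp (A + (1 / 2 : ℝ) • fderiv ℝ u z))

theorem primitive_apply (A : ℍ[ℝ] →L[ℝ] ℍ[ℝ]) (u : ℍ[ℝ] → ℍ[ℝ]) (z v : ℍ[ℝ]) :
    primitive A u z ![v] = inner ℝ (rightI (u z)) (A v + (1 / 2 : ℝ) • fderiv ℝ u z v) := rfl

theorem periodic_primitive (A : ℍ[ℝ] →L[ℝ] ℍ[ℝ]) {u : ℍ[ℝ] → ℍ[ℝ]} {w : ℍ[ℝ]}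
    (hu : Function.Periodic u w) : Function.Periodic (primitive A u) w := fun z => by
  rw [primitive, primitive, hu z, periodic_fderiv hu z]

variable (A : ℍ[ℝ] →L[ℝ] ℍ[ℝ]) {u : ℍ[ℝ] → ℍ[ℝ]} (hu : ContDiff ℝ ∞ u)
include hu

theorem contDiff_primitive : ContDiff ℝ ∞ (primitive A u) := by
  have hcomp : ContDiff ℝ ∞ fun z => (innerSL ℝ (rightI (u z))).comp
      (A + (1 / 2 : ℝ) • fderiv ℝ u z) :=
    ((innerSL ℝ).contDiff.comp (rightI.contDiff.comp hu)).clm_comp <|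
      contDiff_const.add ((hu.fderiv_right (m := ∞) (by simp)).const_smul (1 / 2 : ℝ))
  exact (ContinuousAlternatingMap.ofSubsingletonLIE (𝕜 := ℝ) (E := ℍ[ℝ]) (F := ℝ)
    (0 : Fin 1)).toContinuousLinearEquiv.contDiff.comp hcomp

theorem fderiv_primitive_apply (z v w : ℍ[ℝ]) : fderiv ℝ (primitive A u) z w ![v] =
    inner ℝ (rightI (u z)) ((1 / 2 : ℝ) • fderiv ℝ (fderiv ℝ u) z w v) +
      inner ℝ (rightI (fderiv ℝ u z w)) (A v + (1 / 2 : ℝ) • fderiv ℝ u z v) := by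
  have hdu : HasFDerivAt u (fderiv ℝ u z) z := (hu.differentiable (by simp) z).hasFDerivAt
  have hddu : HasFDerivAt (fderiv ℝ u) (fderiv ℝ (fderiv ℝ u) z) z :=
    ((hu.fderiv_right (m := ∞) (by simp)).differentiable (by simp) z).hasFDerivAt
  have hleft : HasFDerivAt (fun y => rightI (u y)) (rightI.comp (fderiv ℝ u z)) z :=
    rightI.hasFDerivAt.comp z hdu
  have hright : HasFDerivAt (fun y => A v + (1 / 2 : ℝ) • fderiv ℝ u y v)
      ((1 / 2 : ℝ) • (fderiv ℝ (fderiv ℝ u) z).flip v) z := by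
    have h : HasFDerivAt (fun y => fderiv ℝ u y v) ((fderiv ℝ (fderiv ℝ u) z).flip v) z := by
      simpa using hddu.clm_apply (hasFDerivAt_const v z)
    exact (h.const_smul (1 / 2 : ℝ)).const_add (A v)
  rw [← fderiv_continuousAlternatingMap_apply_const_apply
    ((contDiff_primitive A hu).differentiable (by simp) z)]
  simp only [primitive_apply]
  rw [(hleft.inner ℝ hright).fderiv]
  rfl

theorem extDeriv_primitive (z : ℍ[ℝ]) : extDeriv (primitive A u) z =
    omegaV.compContinuousLinearMap (A + fderiv ℝ u z) - omegaV.compContinuousLinearMap A := by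
  have hsymm : IsSymmSndFDerivAt ℝ u z :=
    hu.contDiffAt.isSymmSndFDerivAt minSmoothness_two_le_infty
  have hpull (B : ℍ[ℝ] →L[ℝ] ℍ[ℝ]) (v w : ℍ[ℝ]) :
      omegaV.compContinuousLinearMap B ![v, w] = inner ℝ (rightI (B v)) (B w) := rfl
  ext x
  obtain ⟨v, w, rfl⟩ : ∃ v w, x = ![v, w] := ⟨x 0, x 1, (List.ofFn_inj.1 rfl)⟩
  rw [extDeriv, alternatizeUncurryFin_one_apply, fderiv_primitive_apply A hu,
    fderiv_primitive_apply A hu, ContinuousAlternatingMap.sub_apply, hpull, hpull, hsymm.eq v w]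
  simp only [add_apply, map_add, inner_add_left, inner_add_right, inner_smul_right]
  rw [inner_rightI_swap (fderiv ℝ u z w) (A v),
    inner_rightI_swap (fderiv ℝ u z w) (fderiv ℝ u z v)]
  ring

end Primitive

section Cohomology

variable {Γ : Submodule ℤ ℍ[ℝ]} [DiscreteTopology Γ] {f : SmoothMap Γ} {F : ℍ[ℝ] → ℍ[ℝ]}

theorem Form.lift_sub {k : ℕ} (α β : Form Γ k) (z : ℍ[ℝ]) :
    (α - β).lift z = α.lift z - β.lift z := rfl

theorem IsSmoothLift.lift_pullback_omegaM_eq_extDeriv (h : IsSmoothLift f F) :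
    ((omegaM Γ).pullback f).lift = extDeriv (primitive 0 F) := by
  have hzero : omegaV.compContinuousLinearMap (0 : ℍ[ℝ] →L[ℝ] ℍ[ℝ]) = 0 := by
    ext
    exact inner_zero_right (rightI 0)
  funext z
  rw [h.lift_pullback_omegaM, extDeriv_primitive 0 h.contDiff, zero_add, hzero, sub_zero]

theorem Form.isSmooth_pullback_omegaM (f : SmoothMap Γ) : ((omegaM Γ).pullback f).IsSmooth := by
  obtain ⟨F, h⟩ := exists_isSmoothLift f
  rw [Form.IsSmooth, h.lift_pullback_omegaM_eq_extDeriv]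
  exact contDiff_extDeriv (contDiff_primitive 0 h.contDiff) (by simp)

theorem Form.extDeriv_lift_pullback_omegaM (f : SmoothMap Γ) :
    extDeriv ((omegaM Γ).pullback f).lift = 0 := by
  obtain ⟨F, h⟩ := exists_isSmoothLift f
  rw [h.lift_pullback_omegaM_eq_extDeriv]
  exact extDeriv_extDeriv (contDiff_primitive 0 h.contDiff) minSmoothness_two_le_infty

namespace IsEquivariantLift

variable {A : ℍ[ℝ] →L[ℝ] ℍ[ℝ]} (h : IsEquivariantLift f F A)
include h

theorem periodic_sub : ∀ w ∈ Γ, Function.Periodic (fun z => F z - A z) w := fun w hw z => by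
  simp only [h.add_mem z w hw, map_add, add_sub_add_right_eq_sub]

theorem contDiff_sub : ContDiff ℝ ∞ fun z => F z - A z :=
  h.contDiff.sub A.contDiff

theorem extDeriv_primitive_sub (z : ℍ[ℝ]) : extDeriv (primitive A fun z => F z - A z) z =
    ((omegaM Γ).pullback f).lift z - omegaV.compContinuousLinearMap A := by
  rw [extDeriv_primitive A h.contDiff_sub, h.lift_pullback_omegaM,
    fderiv_fun_sub (h.contDiff.differentiable (by simp) z) A.differentiableAt, A.fderiv,
    add_sub_cancel]

theorem isSymplecticLinear [IsZLattice ℝ Γ] (hf : PreservesClass f) : IsSymplecticLinear A := by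
  obtain ⟨η, hη, hdη⟩ := hf
  have hη' : ContDiff ℝ ∞ η.lift := hη
  have hp := contDiff_primitive A h.contDiff_sub
  refine sub_eq_zero.1 (eq_zero_of_extDeriv_eq_const_of_periodic (L := Γ)
    (η := η.lift - primitive A fun z => F z - A z) ((hη'.sub hp).of_le (by simp))
    (fun w hw => (η.periodic_lift hw).sub (periodic_primitive A (h.periodic_sub w hw)))
    fun z => ?_)
  rw [extDeriv_sub (hη'.differentiable (by simp) z) (hp.differentiable (by simp) z), ← hdη,
    h.extDeriv_primitive_sub, Form.lift_sub, Form.lift_omegaM, sub_sub_sub_cancel_left]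

theorem preservesClass (hA : IsSymplecticLinear A) : PreservesClass f := by
  obtain ⟨η, hη⟩ := Form.exists_lift_eq fun w hw => periodic_primitive A (h.periodic_sub w hw)
  refine ⟨η, ?_, funext fun z => ?_⟩
  · rw [Form.IsSmooth, hη]
    exact contDiff_primitive A h.contDiff_sub
  · rw [hη, h.extDeriv_primitive_sub, hA, Form.lift_sub, Form.lift_omegaM]

end IsEquivariantLift

end Cohomology

/-! ### Global inversion of proper local homeomorphisms -/

section GlobalInversion

variable {X Y : Type*} [TopologicalSpace X] [TopologicalSpace Y] {f : X → Y}

theorem isCoveringMap_of_isProperMap [T2Space X] [T1Space Y] (hf : IsLocalHomeomorph f)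
    (hp : IsProperMap f) : IsCoveringMap f := by
  rw [isCoveringMap_iff_isCoveringMapOn_univ]
  refine hp.isClosedMap.isCoveringMapOn_of_isLocalHomeomorphOn (fun y _ => ?_) ?_
  · refine (hp.isCompact_preimage isCompact_singleton).finite
      (IsDiscrete.of_openPartialHomeomorph f subset_rfl fun x _ => ?_)
    obtain ⟨φ, hφ, h⟩ := hf x
    exact ⟨φ, hφ, h.symm⟩
  · rw [Set.preimage_univ]
    exact isLocalHomeomorph_iff_isLocalHomeomorphOn_univ.1 hf

theorem bijective_of_isCoveringMap [Nonempty X] [PreconnectedSpace X] [SimplyConnectedSpace Y]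
    [LocallyPathConnectedSpace Y] (hf : IsCoveringMap f) : Function.Bijective f := by
  have hsection (x : X) : ∃ s : C(Y, X), s (f x) = x ∧ f ∘ s = id :=
    (hf.existsUnique_continuousMap_lifts (ContinuousMap.id Y) (f x) x rfl).exists
  refine ⟨fun x x' hxx => ?_, ?_⟩
  · obtain ⟨s, hs, hfs⟩ := hsection x'
    have hsf : s ∘ f = id := hf.eq_of_comp_eq (s.continuous.comp hf.continuous) continuous_id
      (by rw [← Function.comp_assoc, hfs]; rfl) x' hs
    calc x = s (f x) := (congrFun hsf x).symm
      _ = s (f x') := by rw [hxx]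
      _ = x' := hs
  · obtain ⟨s, -, hfs⟩ := hsection (Classical.arbitrary X)
    exact fun y => ⟨s y, congrFun hfs y⟩

theorem isProperMap_of_norm_sub_le {E : Type*} [NormedAddCommGroup E] [ProperSpace E]
    {f φ : X → E} (hφ : IsProperMap φ) (hf : Continuous f) {C : ℝ} (hC : ∀ x, ‖f x - φ x‖ ≤ C) :
    IsProperMap f := by
  have htendsto {ψ : X → E} : Filter.Tendsto ψ (Filter.cocompact X) (Filter.cocompact E) ↔
      Filter.Tendsto (fun x => ‖ψ x‖) (Filter.cocompact X) Filter.atTop := by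
    rw [← Metric.cobounded_eq_cocompact, ← tendsto_norm_atTop_iff_cobounded]
  refine isProperMap_iff_tendsto_cocompact.2 ⟨hf, htendsto.2 ?_⟩
  refine Filter.tendsto_atTop_mono (fun x => ?_) (Filter.tendsto_atTop_add_const_right _ (-C)
    (htendsto.1 (isProperMap_iff_tendsto_cocompact.1 hφ).2))
  have htriangle := norm_sub_norm_le (φ x) (f x)
  rw [norm_sub_rev] at htriangle
  linarith [hC x]

/-- Hadamard's global inverse function theorem. -/
theorem exists_homeomorph_of_contDiff_of_isProperMap {E E' : Type*} [NormedAddCommGroup E]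
    [NormedSpace ℝ E] [CompleteSpace E] [NormedAddCommGroup E'] [NormedSpace ℝ E'] {F : E → E'}
    {n : ℕ∞ω} (hF : ContDiff ℝ n F) (hn : n ≠ 0) (hp : IsProperMap F)
    (hinv : ∀ z, ∃ e : E ≃L[ℝ] E', (e : E →L[ℝ] E') = fderiv ℝ F z) :
    ∃ e : E ≃ₜ E', ⇑e = F ∧ ContDiff ℝ n e.symm := by
  choose F' hF' using hinv
  have hstrict (z : E) : HasStrictFDerivAt F (F' z : E →L[ℝ] E') z := by
    rw [hF']
    exact hF.hasStrictFDerivAt hn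
  have hloc : IsLocalHomeomorph F := IsLocalHomeomorph.mk F fun z =>
    ⟨(hstrict z).toOpenPartialHomeomorph F, (hstrict z).mem_toOpenPartialHomeomorph_source,
      fun _ _ => rfl⟩
  let e := hloc.toHomeomorphOfBijective
    (bijective_of_isCoveringMap (isCoveringMap_of_isProperMap hloc hp))
  exact ⟨e, rfl, e.contDiff_symm (f₀' := F') (fun z => (hstrict z).hasFDerivAt) hF⟩

end GlobalInversion

/-! ### Symplectic diffeomorphisms -/

section SymplecticMaps

variable {Γ : Submodule ℤ ℍ[ℝ]} [DiscreteTopology Γ]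

theorem homotopic_of_periodic_sub {f g : SmoothMap Γ} {F G : ℍ[ℝ] → ℍ[ℝ]} (hF : IsSmoothLift f F)
    (hG : IsSmoothLift g G) (hper : ∀ w ∈ Γ, Function.Periodic (fun z => F z - G z) w) :
    ContinuousMap.Homotopic (f : C(Torus Γ, Torus Γ)) g := by
  obtain ⟨u, hu⟩ := exists_comp_proj_eq hper
  have hu_cont : Continuous u := by
    rw [((isCoveringMap_proj Γ).isQuotientMap (proj_surjective Γ)).continuous_iff]
    exact (hF.contDiff.continuous.sub hG.contDiff.continuous).congr fun z => (hu z).symm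
  have hp_cont : Continuous (proj Γ) := contMDiff_proj.continuous
  refine ⟨⟨⟨fun q => f q.2 - proj Γ ((q.1 : ℝ) • u q.2), ?_⟩, fun x => ?_, fun x => ?_⟩⟩
  · exact (f.contMDiff.continuous.comp continuous_snd).sub (hp_cont.comp (by fun_prop))
  · change f x - proj Γ ((0 : ℝ) • u x) = f x
    rw [zero_smul]
    exact sub_zero _
  · change f x - proj Γ ((1 : ℝ) • u x) = g x
    obtain ⟨z, rfl⟩ := proj_surjective Γ x
    rw [one_smul, hu, ← hF.proj_apply, ← hG.proj_apply]
    change proj Γ (F z - (F z - G z)) = _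
    rw [sub_sub_cancel]

theorem IsSymplecticDiffeo.preservesClass {g : SmoothMap Γ} (hg : IsSymplecticDiffeo g) :
    PreservesClass g := by
  have hzero : (0 : Form Γ 1).lift = fun _ => 0 := rfl
  refine ⟨0, ?_, ?_⟩
  · rw [Form.IsSmooth, hzero]
    exact contDiff_const
  · rw [Form.IsExtDeriv, hg.2, sub_self, hzero, extDeriv_const]
    rfl

namespace IsEquivariantLift

variable {f g : SmoothMap Γ} {F : ℍ[ℝ] → ℍ[ℝ]} {A : ℍ[ℝ] →L[ℝ] ℍ[ℝ]}
  (h : IsEquivariantLift f F A)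
include h

open scoped unitInterval in
theorem exists_of_homotopic
    (hfg : ContinuousMap.Homotopic (f : C(Torus Γ, Torus Γ)) g) :
    ∃ G, IsEquivariantLift g G A := by
  obtain ⟨H⟩ := hfg
  let Hp : C(I × ℍ[ℝ], Torus Γ) :=
    H.toContinuousMap.comp (.prodMap (.id I) ⟨proj Γ, contMDiff_proj.continuous⟩)
  have hHp (z : ℍ[ℝ]) : Hp (0, z) = proj Γ ((⟨F, h.contDiff.continuous⟩ : C(ℍ[ℝ], ℍ[ℝ])) z) :=
    (H.apply_zero _).trans (h.proj_apply z).symm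
  let K := (isCoveringMap_proj Γ).liftHomotopy Hp _ hHp
  have hK (t : I) (z : ℍ[ℝ]) : proj Γ (K (t, z)) = H (t, proj Γ z) :=
    congrFun ((isCoveringMap_proj Γ).liftHomotopy_lifts Hp _ hHp) (t, z)
  have hK_zero (z : ℍ[ℝ]) : K (0, z) = F z :=
    (isCoveringMap_proj Γ).liftHomotopy_zero Hp _ hHp z
  have hg : IsSmoothLift g fun z => K (1, z) :=
    .of_continuous g (by fun_prop) fun z => (hK 1 z).trans (H.apply_one _)
  refine ⟨_, hg, h.map_mem, fun z w hw => ?_⟩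
  have : DiscreteTopology (Γ : Set ℍ[ℝ]) := ‹DiscreteTopology Γ›
  have hconst := eq_of_continuous_of_mem_discrete (s := Γ)
    (g := fun t : I => K (t, z + w) - K (t, z)) (by fun_prop)
    (fun t => (proj_eq_iff Γ).1 (by rw [hK, hK, proj_add_of_mem z hw])) 1 0
  simp only [hK_zero, h.add_mem z w hw, add_sub_cancel_left] at hconst
  exact sub_eq_iff_eq_add'.1 hconst

variable [IsZLattice ℝ Γ]

theorem isProperMap (hA : IsSymplecticLinear A) : IsProperMap F := by
  obtain ⟨e, rfl⟩ := hA.exists_continuousLinearEquiv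
  obtain ⟨C, hC⟩ := exists_norm_le_of_periodic Γ h.contDiff_sub.continuous h.periodic_sub
  exact isProperMap_of_norm_sub_le e.toHomeomorph.isProperMap h.contDiff.continuous hC

theorem isSymplecticDiffeo (hA : IsSymplecticLinear A)
    (hf : (omegaM Γ).pullback f = omegaM Γ) : IsSymplecticDiffeo f := by
  have hF (z : ℍ[ℝ]) : IsSymplecticLinear (fderiv ℝ F z) := by
    rw [IsSymplecticLinear, ← h.lift_pullback_omegaM, hf, Form.lift_omegaM]
  obtain ⟨e, rfl, he⟩ := exists_homeomorph_of_contDiff_of_isProperMap h.contDiff (by simp)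
    (h.isProperMap hA) fun z => (hF z).exists_continuousLinearEquiv
  obtain ⟨g, hg⟩ := exists_smoothMap_of_lift (Γ := Γ) he fun w hw z => by
    obtain ⟨w', hw', rfl⟩ :=
      surjOn_lattice_of_comp_eq h.map_mem omegaBilin_nondegenerate hA.omegaBilin_comp_eq hw
    have hsymm : e.symm (z + A w') = e.symm z + w' := by
      rw [e.symm_apply_eq, h.add_mem _ _ hw', e.apply_symm_apply]
    exact (congrArg (proj Γ) hsymm).trans (proj_add_of_mem _ hw')
  refine ⟨⟨⟨⟨f, g, fun x => ?_, fun x => ?_⟩, f.contMDiff, g.contMDiff⟩, fun x => rfl⟩, hf⟩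
  · obtain ⟨z, rfl⟩ := proj_surjective Γ x
    rw [← h.proj_apply, ← hg.proj_apply, e.symm_apply_apply]
  · obtain ⟨z, rfl⟩ := proj_surjective Γ x
    rw [← hg.proj_apply, ← h.proj_apply, e.apply_symm_apply]

end IsEquivariantLift

end SymplecticMaps

/-! ### Self-dual forms on the torus -/

section Conclusion

variable {Γ : Submodule ℤ ℍ[ℝ]} [DiscreteTopology Γ]

theorem Form.isHarmonic_of_isSelfDual {α : Form Γ 2} (hα : α.IsSmooth)
    (hclosed : extDeriv α.lift = 0) (hsd : α.IsSelfDual) : Form.IsHarmonic (k := 1) α := by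
  have hco : codiff (k := 1) α.lift = fun _ => 0 := codiff_eq_zero_of_asdTrace_eq_zero
    (ContDiff.differentiable hα (by simp)) ((Form.isSelfDual_iff α).1 hsd) hclosed
  refine ⟨hα, fun z => ?_⟩
  have hzero : codiff (k := 2) (0 : ℍ[ℝ] → ℍ[ℝ] [⋀^Fin 3]→L[ℝ] ℝ) z = 0 := by
    simp [codiff]
  rw [hco, hclosed, extDeriv_const]
  exact (zero_add _).trans hzero

theorem Form.IsSelfDual.sub {α β : Form Γ 2} (hα : α.IsSelfDual) (hβ : β.IsSelfDual) :
    (α - β).IsSelfDual := by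
  rw [Form.isSelfDual_iff] at *
  intro z
  rw [Form.lift_sub, asdTrace_sub, hα, hβ, sub_zero]

theorem omegaM_isSelfDual : (omegaM Γ).IsSelfDual := by
  simp only [Form.isSelfDual_iff, Form.lift_omegaM, asdTrace_omegaV, implies_true]

variable [IsZLattice ℝ Γ]

theorem Form.eq_zero_of_isExact_of_isSelfDual {α : Form Γ 2} (hα : Form.IsExact (k := 1) α)
    (hsd : α.IsSelfDual) : α = 0 := by
  obtain ⟨η, hη, hd⟩ := hα
  rw [Form.isSelfDual_iff, hd] at hsd
  refine Form.lift_injective ?_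
  rw [hd, extDeriv_eq_zero_of_periodic_of_asdTrace_eq_zero hη (fun w hw => η.periodic_lift hw) hsd]
  rfl

theorem isHomotopicToSymplectic_iff (f : SmoothMap Γ) :
    IsHomotopicToSymplectic f ↔ PreservesClass f := by
  obtain ⟨F, A, h⟩ := exists_isEquivariantLift f
  constructor
  · rintro ⟨g, hg, hfg⟩
    obtain ⟨G, hG⟩ := h.exists_of_homotopic hfg
    exact h.preservesClass (hG.isSymplecticLinear hg.preservesClass)
  · intro hf
    have hA := h.isSymplecticLinear hf
    have hAper : ∀ w ∈ Γ, ∀ z, proj Γ (A (z + w)) = proj Γ (A z) := fun w hw z => by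
      rw [map_add, proj_add_of_mem _ (h.map_mem w hw)]
    obtain ⟨g, hg⟩ := exists_smoothMap_of_lift (Γ := Γ) A.contDiff hAper
    have hgA : IsEquivariantLift g A A := ⟨hg, h.map_mem, fun z w _ => map_add A z w⟩
    have hpull : (omegaM Γ).pullback g = omegaM Γ := by
      refine Form.lift_injective (funext fun z => ?_)
      rw [hg.lift_pullback_omegaM, A.fderiv, hA, Form.lift_omegaM]
    exact ⟨g, hgA.isSymplecticDiffeo hA hpull,
      homotopic_of_periodic_sub h.toIsSmoothLift hg h.periodic_sub⟩

theorem isSymplecticDiffeo_iff_of_preservesClass {f : SmoothMap Γ} (hf : PreservesClass f) :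
    IsSymplecticDiffeo f ↔ hyperMomentMap (differential f) = 0 := by
  rw [hyperMomentMap_eq_zero_iff]
  refine ⟨fun h => by rw [h.2]; exact omegaM_isSelfDual, fun h => ?_⟩
  obtain ⟨F, A, hF⟩ := exists_isEquivariantLift f
  refine hF.isSymplecticDiffeo (hF.isSymplecticLinear hf) (sub_eq_zero.1 ?_)
  exact Form.eq_zero_of_isExact_of_isSelfDual hf (h.sub omegaM_isSelfDual)

end Conclusion

end HyperKahlerTorus

theorem theoremB (Γ : Submodule ℤ ℍ[ℝ]) [DiscreteTopology Γ] [IsZLattice ℝ Γ] :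
    -- a smooth map is homotopic to a symplectic diffeomorphism iff it preserves the class of `ω_M`
    (∀ f : SmoothMap Γ, IsHomotopicToSymplectic f ↔ PreservesClass f) ∧
    -- for such a map: symplectic diffeomorphism iff zero of the moment map
    (∀ f : SmoothMap Γ, IsHomotopicToSymplectic f →
      (IsSymplecticDiffeo f ↔ hyperMomentMap (differential f) = 0)) ∧
    (∀ f : SmoothMap Γ, PreservesClass f →
      (IsSymplecticDiffeo f ↔ hyperMomentMap (differential f) = 0)) ∧
    -- for every smooth map: zero of the moment map iff the pullback is self-dual (and harmonic)
    (∀ f : SmoothMap Γ, hyperMomentMap (differential f) = 0 ↔ ((omegaM Γ).pullback f).IsSelfDual) ∧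
    (∀ f : SmoothMap Γ, hyperMomentMap (differential f) = 0 ↔
      ((omegaM Γ).pullback f).IsSelfDual ∧ Form.IsHarmonic (k := 1) ((omegaM Γ).pullback f)) ∧
    -- an exact self-dual form vanishes
    (∀ α : Form Γ 2, Form.IsExact (k := 1) α → α.IsSelfDual → α = 0) :=
  ⟨isHomotopicToSymplectic_iff,
    fun f hf => isSymplecticDiffeo_iff_of_preservesClass ((isHomotopicToSymplectic_iff f).1 hf),
    fun _ hf => isSymplecticDiffeo_iff_of_preservesClass hf,
    hyperMomentMap_eq_zero_iff,
    fun f => (hyperMomentMap_eq_zero_iff f).trans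
      ⟨fun h => ⟨h, Form.isHarmonic_of_isSelfDual (Form.isSmooth_pullback_omegaM f)
        (Form.extDeriv_lift_pullback_omegaM f) h⟩, And.left⟩,
    fun _ => Form.eq_zero_of_isExact_of_isSelfDual⟩
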